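/- Let $\zeta\ge 2$ and $d$ be natural numbers, let $\mathbb{S}^{\zeta-1}\subset\mathbb{R}^\zeta$ be the unit sphere and let $\mathbb{MS}(\zeta,d)=(\mathbb{S}^{\zeta-1})^d$ be the multisphere, with its uniform probability measure $\mu$; write $\mathbf{x}=(\mathbf{x}^{(1)},\dots,\mathbf{x}^{(d)})$ for its points. Let $\boldsymbol{k}:\mathbb{MS}(\zeta,d)\times\mathbb{MS}(\zeta,d)\to\mathbb{R}$ be a factorizable multi-dot product kernel, i.e. $\boldsymbol{k}(\mathbf{x},\mathbf{z})=\prod_{i=1}^d \boldsymbol{k}_i(\langle\mathbf{x}^{(i)},\mathbf{z}^{(i)}\rangle)$ for some functions $\boldsymbol{k}_i$, and suppose that it is given by a convergent multivariate power series $$\boldsymbol{k}(\mathbf{x},\mathbf{z})=\sum_{\mathbf{n}\in\mathbb{N}^d} b_{\mathbf{n}}\,\prod_{i=1}^d\langle\mathbf{x}^{(i)},\mathbf{z}^{(i)}\rangle^{n_i},\qquad b_{\mathbf{n}}\ge 0 .$$ Let $\mathcal{R}\subseteq\{1,\dots,d\}$ be its receptive field, i.e. the set of those $i$ for which there is $\mathbf{n}$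 with $n_i\ge1$ and $b_{\mathbf{n}}\ne0$ (so $b_{\mathbf n}=0$ if $n_i>0$ for some $i\notin\mathcal R$). Suppose that for some constant $c>0$ and some non-integer $\nu>1$ $$b_{\mathbf{n}}\sim c\prod_{i\in\mathcal{R},\,n_i>0} n_i^{-\nu}$$ as $n_i\to\infty$ for all $i\in\mathcal{R}$ jointly, with $n_i=0$ for $i\notin\mathcal{R}$; here $f\sim g$ means $f/g\to1$. A spherical harmonic of frequency $k$ is the restriction to $\mathbb{S}^{\zeta-1}$ of a homogeneous harmonic polynomial of degree $k$, and an SH-product of frequencies $\mathbf{k}\in\mathbb{N}^d$ is a function $\mathbf{x}\mapsto\prod_{i=1}^d Y_i(\mathbf{x}^{(i)})$ with each $Y_i$ a spherical harmonic of frequency $k_i$. Then: 1. The eigenfunctions of $\boldsymbol{k}$ with respect to the uniform measure are the SH-products: there are reals $\lambda_{\mathbf{k}}$, $\mathbf{k}\in\mathbb{N}^d$, such that every SH-product $Y$ of frequencies $\mathbf{k}$ satisfies $\int \boldsymbol{k}(\mathbf{x},\mathbf{z})Y(\mathbf{z})\,d\mu(\mathbf{z})=\lambda_{\mathbf{k}}Y(\mathbf{x})$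 for all $\mathbf{x}$; and if for each $k$ one chooses an orthonormal basis $(Y_{k,j})_j$ of the spherical harmonics of frequency $k$, then the SH-products $\prod_{i=1}^d Y_{k_i,j_i}(\mathbf{x}^{(i)})$ form an orthonormal basis of $L^2(\mu)$. 2. The eigenvalues satisfy $$\lambda_{\mathbf{k}}\sim\tilde c\prod_{i\in\mathcal{R},\,k_i>0}k_i^{-(\zeta+2\nu-3)}$$ with a constant $\tilde c>0$ as $k_i\to\infty$ for all $i\in\mathcal{R}$ jointly (and $k_i=0$ for $i\notin\mathcal R$). More generally, for every $S\subseteq\mathcal{R}$ the same holds, with a constant $\tilde c=\tilde c_S>0$, as $k_i\to\infty$ for all $i\in S$ jointly and $k_i=0$ for $i\notin S$. Moreover there are $c_1,c_2>0$ such that $c_1\prod_{i\in\mathcal{R},k_i>0}k_i^{-(\zeta+2\nu-3)}\le\lambda_{\mathbf{k}}\le c_2\prod_{i\in\mathcal{R},k_i>0}k_i^{-(\zeta+2\nu-3)}$ for all $\mathbf{k}$ with $k_i=0$ for $i\notin\mathcal{R}$. 3. $\lambda_{\mathbf{k}}=0$ whenever $k_i>0$ for some $i\notin\mathcal{R}$.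 -/

import Mathlib

open MeasureTheory
open scoped Asymptotics

noncomputable section

namespace Multisphere

/-- The unit sphere `𝕊^{ζ-1}` of `ℝ^ζ` (Euclidean norm). -/
abbrev Sph (ζ : ℕ) : Type := Metric.sphere (0 : EuclideanSpace ℝ (Fin ζ)) 1

/-- The multisphere: a product of `d` copies of `𝕊^{ζ-1}`; `x i` is the `i`-th pixel. -/
abbrev MS (ζ d : ℕ) : Type := Fin d → Sph ζ

/-- The uniform probability measure on the sphere: the normalized surface measure. -/
def unifSph (ζ : ℕ) : Measure (Sph ζ) :=
  ProbabilityTheory.cond (volume : Measure (EuclideanSpace ℝ (Fin ζ))).toSphere Set.univ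

instance (ζ : ℕ) : IsFiniteMeasure (unifSph ζ) := by
  unfold unifSph; infer_instance

/-- The uniform probability measure on the multisphere. -/
def unif (ζ d : ℕ) : Measure (MS ζ d) := Measure.pi fun _ => unifSph ζ

instance (ζ d : ℕ) : IsFiniteMeasure (unif ζ d) := by
  unfold unif; infer_instance

/-- The vector `t = (⟨x⁽¹⁾,z⁽¹⁾⟩, …, ⟨x⁽ᵈ⁾,z⁽ᵈ⁾⟩)` of inner products of corresponding pixels. -/
def dots {ζ d : ℕ} (x z : MS ζ d) : Fin d → ℝ :=
  fun i => inner ℝ (x i : EuclideanSpace ℝ (Fin ζ)) (z i : EuclideanSpace ℝ (Fin ζ))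

/-! ### Spherical harmonics -/

/-- The coordinate function `x ↦ x_j` on the sphere. -/
def coord (ζ : ℕ) (j : Fin ζ) : C(Sph ζ, ℝ) where
  toFun x := (x : EuclideanSpace ℝ (Fin ζ)) j
  continuous_toFun := by fun_prop

/-- Restriction of polynomials in `ζ` variables to the sphere. -/
def restrictSph (ζ : ℕ) : MvPolynomial (Fin ζ) ℝ →ₐ[ℝ] C(Sph ζ, ℝ) :=
  MvPolynomial.aeval (coord ζ)

/-- The Laplacian `∑ ∂²/∂x_j²` on polynomials in `ζ` variables. -/
def polyLaplacian (ζ : ℕ) : MvPolynomial (Fin ζ) ℝ →ₗ[ℝ] MvPolynomial (Fin ζ) ℝ :=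
  ∑ j, (MvPolynomial.pderiv j).toLinearMap ∘ₗ (MvPolynomial.pderiv j).toLinearMap

/-- The spherical harmonics of frequency `k` on `𝕊^{ζ-1}`: the restrictions to the sphere of the
homogeneous harmonic polynomials of degree `k`. -/
def sphHarm (ζ k : ℕ) : Submodule ℝ C(Sph ζ, ℝ) :=
  (MvPolynomial.homogeneousSubmodule (Fin ζ) ℝ k ⊓ LinearMap.ker (polyLaplacian ζ)).map
    (restrictSph ζ).toLinearMap

/-- `N(ζ,k)`, the number of (linearly independent) harmonics of frequency `k` on `𝕊^{ζ-1}`. -/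
def numHarm (ζ k : ℕ) : ℕ := Module.finrank ℝ (sphHarm ζ k)

/-- `Y k j`, `j = 1, …, N(ζ,k)`, are, for each frequency `k`, orthonormal spherical harmonics of
frequency `k` (hence a basis of the space of those, by the count). -/
def IsHarmonicSystem (ζ : ℕ) (Y : (k : ℕ) → Fin (numHarm ζ k) → C(Sph ζ, ℝ)) : Prop :=
  (∀ k j, Y k j ∈ sphHarm ζ k) ∧
    ∀ k j j', ∫ x, Y k j x * Y k j' x ∂(unifSph ζ) = if j = j' then 1 else 0

/-- The product function `x ↦ ∏ i, f_i (x⁽ⁱ⁾)` on the multisphere. It is an SH-product of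
frequencies `k` when each `f_i` is a spherical harmonic of frequency `k_i`. -/
def prodFun {ζ d : ℕ} (f : Fin d → C(Sph ζ, ℝ)) : C(MS ζ d, ℝ) where
  toFun x := ∏ i, f i (x i)
  continuous_toFun := by fun_prop

/-- The SH-product `Y_{k,j} = ∏ i, Y_{k_i j_i}(x⁽ⁱ⁾)`, indexed by the pair `(k, j)`. -/
def shProduct {ζ d : ℕ} (Y : (k : ℕ) → Fin (numHarm ζ k) → C(Sph ζ, ℝ))
    (p : Σ k : Fin d → ℕ, (i : Fin d) → Fin (numHarm ζ (k i))) : C(MS ζ d, ℝ) :=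
  prodFun fun i => Y (p.1 i) (p.2 i)

/-! ### Kernels -/

/-- `K` is a product of dot-product kernels of the individual pixels (in particular it depends on
`x`, `z` only through `dots x z`, so that it is multi-dot product). -/
def IsFactorizable {ζ d : ℕ} (K : MS ζ d → MS ζ d → ℝ) : Prop :=
  ∃ κ : Fin d → ℝ → ℝ, ∀ x z, K x z = ∏ i, κ i (dots x z i)

/-- `K(x,z) = ∑_{n ≥ 0} b_n t^n` with `t = dots x z`. -/
def HasPowerSeries {ζ d : ℕ} (K : MS ζ d → MS ζ d → ℝ) (b : (Fin d → ℕ) → ℝ) : Prop :=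
  ∀ x z, HasSum (fun n : Fin d → ℕ => b n * ∏ i, dots x z i ^ n i) (K x z)

open Classical in
/-- The receptive field: the indices `i` with `b_n ≠ 0` for some `n` with `n_i ≥ 1`. -/
def receptiveField {d : ℕ} (b : (Fin d → ℕ) → ℝ) : Finset (Fin d) :=
  Finset.univ.filter fun i => ∃ n : Fin d → ℕ, 1 ≤ n i ∧ b n ≠ 0

/-- The multi-index tends to infinity along the coordinate orthant of `S`: `n_i → ∞` for every
`i ∈ S` (jointly, in an arbitrary manner), while `n_i = 0` for every `i ∉ S`. -/
def atTopOn {d : ℕ} (S : Finset (Fin d)) : Filter (Fin d → ℕ) :=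
  (⨅ i ∈ S, Filter.comap (fun n : Fin d → ℕ => n i) Filter.atTop) ⊓
    Filter.principal {n | ∀ i ∉ S, n i = 0}

/-- `∏_{i ∈ R, n_i > 0} n_i^{-a}`. -/
def powProd {d : ℕ} (R : Finset (Fin d)) (a : ℝ) (n : Fin d → ℕ) : ℝ :=
  ∏ i ∈ R with 0 < n i, (n i : ℝ) ^ (-a)

end Multisphere

end

/-!
A factorizable kernel with nonnegative coefficients has `b n = A * ∏ i, ρ i (n i)` with each `ρ i`
a probability distribution on `ℕ`, supported at `0` exactly when `i` is outside the receptive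
field. Its eigenvalues are therefore products of one-pixel eigenvalues `∑' m, ρ i m * (eigenvalue of
⟪x, z⟫ ^ m)`.

On spherical harmonics of frequency `k`, the power `⟪x, z⟫ ^ m` has eigenvalue `0` unless
`m = k + 2 * j`, and then a quotient of Gamma values. For the comparison coefficients
`Γ (m - s) / m!` with `s = ν - 1`, which decay like `m ^ (-ν)`, the one-pixel series is a Gauss
hypergeometric series at `1`, so its sum is a multiple of `Γ (k - s) / Γ (k + s + ζ - 1)`, of order
`k ^ (-(ζ + 2 * ν - 3))`. Since only powers `m ≥ k` contribute, the asymptotics of `ρ i` transfers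
to its eigenvalues.
-/

noncomputable section

namespace Multisphere

open Filter Topology Real Set

section Gamma

lemma Gamma_add_natCast {x : ℝ} (hx : ∀ m : ℕ, x ≠ -m) (n : ℕ) :
    Gamma (x + n) = Gamma x * ∏ j ∈ Finset.range n, (x + j) := by
  induction n with
  | zero => simp
  | succ n ih =>
    have hne : x + n ≠ 0 := fun h => hx n (by linarith)
    rw [Finset.prod_range_succ, ← mul_assoc, ← ih, Nat.cast_succ, ← add_assoc, Gamma_add_one hne,
      mul_comm]

lemma isEquivalent_natCast_add (x : ℝ) :
    (fun n : ℕ => (n : ℝ) + x) ~[atTop] fun n : ℕ => (n : ℝ) :=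
  Asymptotics.IsEquivalent.refl.add_isLittleO
    (Asymptotics.isLittleO_const_id_atTop x |>.comp_tendsto tendsto_natCast_atTop_atTop)

/-- Euler's limit formula for `Γ`, rearranged. -/
lemma isEquivalent_Gamma_natCast_add_one_add {x : ℝ} (hx : ∀ m : ℕ, x ≠ -m) :
    (fun n : ℕ => Gamma (n + (x + 1))) ~[atTop] fun n : ℕ => (n : ℝ) ^ x * n.factorial := by
  refine (Asymptotics.isEquivalent_of_tendsto_one ?_).symm
  have hlim := (GammaSeq_tendsto_Gamma x).const_mul (Gamma x)⁻¹
  rw [inv_mul_cancel₀ (Gamma_ne_zero hx)] at hlim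
  refine hlim.congr fun n => ?_
  have hprod := Gamma_add_natCast hx (n + 1)
  rw [show x + ((n + 1 : ℕ) : ℝ) = n + (x + 1) by push_cast; ring] at hprod
  rw [Pi.div_apply, GammaSeq, hprod, ← div_div, inv_mul_eq_div, div_right_comm]

lemma isEquivalent_Gamma_natCast_add (x : ℝ) :
    (fun n : ℕ => Gamma (n + x)) ~[atTop] fun n : ℕ => (n : ℝ) ^ (x - 1) * n.factorial := by
  have of_add_one : ∀ y : ℝ,
      (fun n : ℕ => Gamma (n + (y + 1))) ~[atTop] (fun n : ℕ => (n : ℝ) ^ y * n.factorial) →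
      (fun n : ℕ => Gamma (n + y)) ~[atTop] fun n : ℕ => (n : ℝ) ^ (y - 1) * n.factorial := by
    intro y hy
    refine ((hy.div (isEquivalent_natCast_add y)).congr_left ?_).congr_right ?_
    · have hlim := tendsto_atTop_add_const_right atTop y (tendsto_natCast_atTop_atTop (R := ℝ))
      filter_upwards [hlim.eventually_gt_atTop 0] with n hn
      rw [Pi.div_apply, ← add_assoc, Gamma_add_one hn.ne', mul_div_cancel_left₀ _ hn.ne']
    · filter_upwards [eventually_gt_atTop 0] with n hn
      rw [Pi.div_apply, rpow_sub_one (by positivity), div_mul_eq_mul_div]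
  have shifted : ∀ N : ℕ, ∀ y : ℝ, 0 < y + N →
      (fun n : ℕ => Gamma (n + (y + 1))) ~[atTop] fun n : ℕ => (n : ℝ) ^ y * n.factorial := by
    intro N
    induction N with
    | zero =>
      intro y hy
      refine isEquivalent_Gamma_natCast_add_one_add fun m h => ?_
      have : (0 : ℝ) ≤ m := m.cast_nonneg
      rw [Nat.cast_zero] at hy
      linarith
    | succ N ih =>
      intro y hy
      have hy' : 0 < y + 1 + N := by push_cast at hy; linarith
      simpa using of_add_one _ (ih (y + 1) hy')
  obtain ⟨N, hN⟩ := exists_nat_gt (-x)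
  exact of_add_one x (shifted N x (by linarith))

lemma isEquivalent_Gamma_div_Gamma (x y : ℝ) :
    (fun n : ℕ => Gamma (n + x) / Gamma (n + y)) ~[atTop] fun n : ℕ => (n : ℝ) ^ (x - y) := by
  refine ((isEquivalent_Gamma_natCast_add x).div (isEquivalent_Gamma_natCast_add y)).congr_right ?_
  filter_upwards [eventually_gt_atTop 0] with n hn
  have hn' : (0 : ℝ) < n := Nat.cast_pos.2 hn
  rw [Pi.div_apply, mul_div_mul_right _ _ (by positivity), ← rpow_sub hn', sub_sub_sub_cancel_right]

lemma eval_ascPochhammer (x : ℝ) (n : ℕ) :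
    (ascPochhammer ℝ n).eval x = ∏ j ∈ Finset.range n, (x + j) := by
  induction n with
  | zero => simp
  | succ n ih => rw [ascPochhammer_succ_eval, ih, Finset.prod_range_succ]

lemma hasSum_Gamma_mul_pow_div_factorial {a u : ℝ} (ha : ∀ m : ℕ, a ≠ -m) (hu : |u| < 1) :
    HasSum (fun j : ℕ => Gamma (a + j) * u ^ j / j.factorial) (Gamma a * (1 - u) ^ (-a)) := by
  have hball : u ∈ Metric.eball (0 : ℝ) 1 := by
    rwa [← ENNReal.ofReal_one, Metric.eball_ofReal, mem_ball_zero_iff]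
  have h := ((one_div_one_sub_rpow_hasFPowerSeriesOnBall_zero a).hasSum hball).mul_left (Gamma a)
  rw [abs_lt] at hu
  convert! h using 1
  · funext j
    have hchoose := Ring.factorial_nsmul_multichoose_eq_ascPochhammer a j
    rw [Ring.multichoose_eq, Polynomial.ascPochhammer_smeval_eq_eval, eval_ascPochhammer,
      nsmul_eq_mul] at hchoose
    rw [Gamma_add_natCast ha, ← hchoose, FormalMultilinearSeries.ofScalars_apply_eq, smul_eq_mul]
    field_simp
  · rw [zero_add, rpow_neg (by linarith), one_div]

lemma integral_rpow_mul_one_sub_rpow {a b : ℝ} (ha : 0 < a) (hb : 0 < b) :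
    ∫ x in Ioo (0 : ℝ) 1, x ^ (a - 1) * (1 - x) ^ (b - 1) = ProbabilityTheory.beta a b := by
  have hnonneg : ∀ x ∈ Ioo (0 : ℝ) 1,
      0 ≤ 1 / ProbabilityTheory.beta a b * x ^ (a - 1) * (1 - x) ^ (b - 1) := fun x hx =>
    mul_nonneg (mul_nonneg (one_div_nonneg.2 (ProbabilityTheory.beta_pos ha hb).le)
      (rpow_nonneg hx.1.le _)) (rpow_nonneg (sub_nonneg.2 hx.2.le) _)
  have h := ProbabilityTheory.lintegral_betaPDF_eq_one ha hb
  rw [ProbabilityTheory.lintegral_betaPDF, ← ENNReal.toReal_eq_one_iff,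
    ← integral_eq_lintegral_of_nonneg_ae (ae_restrict_of_forall_mem measurableSet_Ioo hnonneg)
      (Measurable.aestronglyMeasurable (by fun_prop))] at h
  simp_rw [mul_assoc, integral_const_mul] at h
  rwa [one_div, inv_mul_eq_one₀ (ProbabilityTheory.beta_pos ha hb).ne', eq_comm] at h

lemma integral_rpow_mul_one_sub_rpow_mul_pow {a b : ℝ} (ha : 0 < a) (hb : 0 < b) (j : ℕ) :
    ∫ x in Ioo (0 : ℝ) 1, x ^ (a - 1) * (1 - x) ^ (b - 1) * x ^ j =
      ProbabilityTheory.beta (a + j) b := by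
  rw [← integral_rpow_mul_one_sub_rpow (by positivity) hb]
  refine setIntegral_congr_fun measurableSet_Ioo fun x hx => ?_
  have hpow : x ^ (a + j - 1) = x ^ (a - 1) * x ^ j := by
    rw [← rpow_natCast x j, ← rpow_add hx.1, add_sub_right_comm]
  simp only [hpow]
  ring

lemma hasSum_integral_of_nonneg {α : Type*} [MeasurableSpace α] {μ : Measure α} {F : ℕ → α → ℝ}
    {f : α → ℝ} (hF : ∀ j, AEStronglyMeasurable (F j) μ) (hF_nonneg : ∀ j, 0 ≤ᵐ[μ] F j)
    (hf : Integrable f μ) (h : ∀ᵐ a ∂μ, HasSum (F · a) (f a)) :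
    HasSum (fun j => ∫ a, F j a ∂μ) (∫ a, f a ∂μ) :=
  hasSum_integral_of_dominated_convergence F hF
    (fun j => (hF_nonneg j).mono fun _ ha => (Real.norm_of_nonneg ha).le)
    (h.mono fun _ ha => ha.summable) (hf.congr (h.mono fun _ ha => ha.tsum_eq.symm)) h

/-- Gauss' summation formula for the hypergeometric series at `1`: integrate the binomial series
of `(1 - u) ^ (-a)` against the beta density with parameters `b` and `c - b`. -/
theorem hasSum_gauss {a b c : ℝ} (ha : 0 < a) (hb : 0 < b) (hc : a + b < c) :
    HasSum (fun j : ℕ => Gamma (a + j) * Gamma (b + j) / (j.factorial * Gamma (c + j)))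
      (Gamma a * Gamma b * Gamma (c - a - b) / (Gamma (c - a) * Gamma (c - b))) := by
  have hcb : 0 < c - b := by linarith
  have hcab : 0 < c - a - b := by linarith
  have hca : 0 < c - a := by linarith
  let F (j : ℕ) (u : ℝ) : ℝ :=
    u ^ (b - 1) * (1 - u) ^ (c - b - 1) * (Gamma (a + j) * u ^ j / j.factorial)
  let f (u : ℝ) : ℝ := Gamma a * (u ^ (b - 1) * (1 - u) ^ (c - a - b - 1))
  have integral_F (j : ℕ) : ∫ u in Ioo (0 : ℝ) 1, F j u =
      Gamma (c - b) * (Gamma (a + j) * Gamma (b + j) / (j.factorial * Gamma (c + j))) := by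
    simp only [F, mul_div_right_comm (Gamma (a + j)), mul_left_comm _ (Gamma (a + j) / j.factorial),
      integral_const_mul, integral_rpow_mul_one_sub_rpow_mul_pow hb hcb, ProbabilityTheory.beta,
      show b + j + (c - b) = c + j by ring]
    ring
  have integral_f : ∫ u in Ioo (0 : ℝ) 1, f u =
      Gamma (c - b) *
        (Gamma a * Gamma b * Gamma (c - a - b) / (Gamma (c - a) * Gamma (c - b))) := by
    rw [integral_const_mul, integral_rpow_mul_one_sub_rpow hb hcab, ProbabilityTheory.beta,
      show b + (c - a - b) = c - a by ring]
    field_simp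
  have F_nonneg (j : ℕ) : ∀ u ∈ Ioo (0 : ℝ) 1, 0 ≤ F j u := fun u hu => by
    have := hu.1
    have := sub_pos.2 hu.2
    positivity
  have hasSum_F : ∀ u ∈ Ioo (0 : ℝ) 1, HasSum (fun j => F j u) (f u) := fun u hu => by
    convert! (hasSum_Gamma_mul_pow_div_factorial
      (fun m => (ha.trans_le' (neg_nonpos.2 m.cast_nonneg)).ne')
      (abs_lt.2 ⟨by linarith [hu.1], hu.2⟩)).mul_left (u ^ (b - 1) * (1 - u) ^ (c - b - 1)) using 1
    simp only [f, show c - a - b - 1 = c - b - 1 + -a by ring, rpow_add (sub_pos.2 hu.2)]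
    ring
  have integrable_f : IntegrableOn f (Ioo 0 1) :=
    .of_integral_ne_zero (integral_f.trans_ne (ne_of_gt (by positivity)))
  have := hasSum_integral_of_nonneg (fun j => Measurable.aestronglyMeasurable (by fun_prop))
    (fun j => ae_restrict_of_forall_mem measurableSet_Ioo (F_nonneg j)) integrable_f
    (ae_restrict_of_forall_mem measurableSet_Ioo hasSum_F)
  simpa only [integral_F, integral_f, hasSum_mul_left_iff (Gamma_pos_of_pos hcb).ne'] using this

end Gamma

section DotProductEigenvalue

/-- The eigenvalue of the kernel `⟨x, z⟩ ^ (k + 2 * j)` on the spherical harmonics of frequency `k`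
on `𝕊^{ζ-1}`. -/
def powEigenvalue (ζ k j : ℕ) : ℝ :=
  Gamma (ζ / 2) * (k + 2 * j).factorial /
    (2 ^ (k + 2 * j) * j.factorial * Gamma (k + j + ζ / 2))

/-- The eigenvalue of the kernel `∑ ρ_m ⟨x, z⟩ ^ m` on the spherical harmonics of frequency `k` on
`𝕊^{ζ-1}`. Only the powers `m = k + 2 * j` contribute. -/
def dotEigenvalue (ζ : ℕ) (ρ : ℕ → ℝ) (k : ℕ) : ℝ := ∑' j, ρ (k + 2 * j) * powEigenvalue ζ k j

variable {ζ : ℕ}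

lemma powEigenvalue_pos (hζ : 0 < ζ) (k j : ℕ) : 0 < powEigenvalue ζ k j := by
  unfold powEigenvalue; positivity

lemma powEigenvalue_zero_zero (hζ : 0 < ζ) : powEigenvalue ζ 0 0 = 1 := by
  have : Gamma ((ζ : ℝ) / 2) ≠ 0 := (Gamma_pos_of_pos (by positivity)).ne'
  simp [powEigenvalue, this]

lemma powEigenvalue_succ_right (hζ : 0 < ζ) (k j : ℕ) :
    (k + 2 * j + 2) * (k + 2 * j + 1) * powEigenvalue ζ k j =
      4 * (j + 1) * (k + j + ζ / 2) * powEigenvalue ζ k (j + 1) := by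
  have hpos : (0 : ℝ) < k + j + ζ / 2 := by positivity
  have := (Gamma_pos_of_pos hpos).ne'
  simp only [powEigenvalue]
  rw [show (k : ℝ) + (j + 1 : ℕ) + ζ / 2 = k + j + ζ / 2 + 1 by push_cast; ring,
    Gamma_add_one hpos.ne', show k + 2 * (j + 1) = k + 2 * j + 1 + 1 by ring, Nat.factorial_succ,
    Nat.factorial_succ, Nat.factorial_succ, pow_succ, pow_succ]
  have := hpos.ne'
  push_cast
  field_simp
  ring

lemma powEigenvalue_succ_left (hζ : 0 < ζ) (k j : ℕ) :
    (k + 2 * j + 1) * powEigenvalue ζ k j =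
      2 * (k + j + ζ / 2) * powEigenvalue ζ (k + 1) j := by
  have hpos : (0 : ℝ) < k + j + ζ / 2 := by positivity
  have := (Gamma_pos_of_pos hpos).ne'
  simp only [powEigenvalue]
  rw [show ((k + 1 : ℕ) : ℝ) + j + ζ / 2 = k + j + ζ / 2 + 1 by push_cast; ring,
    Gamma_add_one hpos.ne', show k + 1 + 2 * j = k + 2 * j + 1 by ring, Nat.factorial_succ,
    pow_succ]
  have := hpos.ne'
  push_cast
  field_simp

lemma Gamma_mul_factorial_le {x : ℝ} (hx : 1 ≤ x) (n : ℕ) :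
    Gamma x * n.factorial ≤ Gamma (n + x) := by
  induction n with
  | zero => simp
  | succ n ih =>
    have : 0 ≤ Gamma (n + x) := (Gamma_pos_of_pos (by positivity)).le
    calc Gamma x * (n + 1).factorial = (n + 1) * (Gamma x * n.factorial) := by
          rw [Nat.factorial_succ]; push_cast; ring
      _ ≤ (n + x) * Gamma (n + x) := by gcongr
      _ = Gamma ((n + 1 : ℕ) + x) := by
          rw [← Gamma_add_one (by positivity)]; push_cast; ring_nf

lemma powEigenvalue_le_one (hζ : 2 ≤ ζ) (k j : ℕ) : powEigenvalue ζ k j ≤ 1 := by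
  have hx : (1 : ℝ) ≤ ζ / 2 := by
    rw [le_div_iff₀ two_pos, one_mul]
    exact_mod_cast hζ
  have hchoose :
      (k + 2 * j).choose j * j.factorial * (k + j).factorial = (k + 2 * j).factorial := by
    simpa [show k + 2 * j - j = k + j by omega] using
      Nat.choose_mul_factorial_mul_factorial (show j ≤ k + 2 * j by omega)
  unfold powEigenvalue
  rw [div_le_one (by positivity)]
  calc Gamma (ζ / 2) * ((k + 2 * j).factorial : ℝ)
      = ((k + 2 * j).choose j : ℝ) * j.factorial * (Gamma (ζ / 2) * (k + j).factorial) := by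
        rw [← hchoose]; push_cast; ring
    _ ≤ 2 ^ (k + 2 * j) * j.factorial * Gamma ((k + j : ℕ) + ζ / 2) := by
        gcongr
        · exact_mod_cast Nat.choose_le_two_pow _ _
        · exact Gamma_mul_factorial_le hx (k + j)
    _ = 2 ^ (k + 2 * j) * j.factorial * Gamma (k + j + ζ / 2) := by rw [Nat.cast_add]

lemma summable_mul_powEigenvalue (hζ : 2 ≤ ζ) {ρ : ℕ → ℝ} (hρ : Summable ρ) (k : ℕ) :
    Summable fun j => ρ (k + 2 * j) * powEigenvalue ζ k j := by
  have hinj : Function.Injective fun j : ℕ => k + 2 * j := fun i j h => by simpa using h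
  refine .of_norm_bounded (hρ.norm.comp_injective hinj) fun j => ?_
  rw [norm_mul, Real.norm_of_nonneg (powEigenvalue_pos (by omega) k j).le]
  exact mul_le_of_le_one_right (norm_nonneg _) (powEigenvalue_le_one hζ k j)

lemma dotEigenvalue_pos (hζ : 2 ≤ ζ) {ρ : ℕ → ℝ} (hnonneg : ∀ m, 0 ≤ ρ m) (hρ : Summable ρ)
    (hpos : ∀ᶠ m in atTop, 0 < ρ m) (k : ℕ) : 0 < dotEigenvalue ζ ρ k := by
  obtain ⟨N, hN⟩ := eventually_atTop.1 hpos
  have hβ := powEigenvalue_pos (show 0 < ζ by omega) k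
  exact (summable_mul_powEigenvalue hζ hρ k).tsum_pos
    (fun j => mul_nonneg (hnonneg _) (hβ j).le) N (mul_pos (hN _ (by omega)) (hβ N))

lemma dotEigenvalue_of_eq_zero (hζ : 0 < ζ) {ρ : ℕ → ℝ} (hρ : ∀ m, 0 < m → ρ m = 0) (k : ℕ) :
    dotEigenvalue ζ ρ k = if k = 0 then ρ 0 else 0 := by
  rw [dotEigenvalue, tsum_eq_single 0 fun j hj => by rw [hρ _ (by omega), zero_mul]]
  split_ifs with hk
  · rw [hk, powEigenvalue_zero_zero hζ, mul_zero, add_zero, mul_one]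
  · rw [hρ _ (by omega), zero_mul]

lemma Gamma_sub_div_factorial_mul_powEigenvalue (hζ : 0 < ζ) (s : ℝ) (k j : ℕ) :
    Gamma ((k + 2 * j : ℕ) - s) / (k + 2 * j).factorial * powEigenvalue ζ k j =
      Gamma (ζ / 2) * 2 ^ (-s - 1) / √π *
        (Gamma ((k - s) / 2 + j) * Gamma ((k - s) / 2 + 1 / 2 + j) /
          (j.factorial * Gamma (k + ζ / 2 + j))) := by
  have duplication := Real.Gamma_mul_Gamma_add_half ((k - s) / 2 + j)
  rw [show (k - s) / 2 + (j : ℝ) + 1 / 2 = (k - s) / 2 + 1 / 2 + j by ring,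
    show 2 * ((k - s) / 2 + (j : ℝ)) = (k + 2 * j : ℕ) - s by push_cast; ring] at duplication
  have hpow : (2 : ℝ) ^ (-s - 1) * 2 ^ (1 - ((k + 2 * j : ℕ) - s)) = (2 ^ (k + 2 * j))⁻¹ := by
    rw [← rpow_add two_pos, ← rpow_natCast, ← rpow_neg two_pos.le]
    congr 1
    ring
  have : Gamma ((k : ℝ) + ζ / 2 + j) ≠ 0 := (Gamma_pos_of_pos (by positivity)).ne'
  rw [duplication, powEigenvalue, show (k : ℝ) + j + ζ / 2 = k + ζ / 2 + j by ring]
  calc _ = Gamma (ζ / 2) * Gamma ((k + 2 * j : ℕ) - s) * (2 ^ (k + 2 * j))⁻¹ /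
        (j.factorial * Gamma (k + ζ / 2 + j)) := by field_simp
    _ = _ := by rw [← hpow]; field_simp

/-- For the coefficients `Γ(m - s) / m!`, which decay like `m ^ (-s - 1)`, the eigenvalues are
available in closed form: by the duplication formula the series is one of Gauss' series at `1`. -/
lemma hasSum_Gamma_sub_div_factorial_mul_powEigenvalue (hζ : 0 < ζ) {s : ℝ}
    (hs : (1 - ζ) / 2 < s) {k : ℕ} (hk : s < k) :
    HasSum (fun j => Gamma ((k + 2 * j : ℕ) - s) / (k + 2 * j).factorial * powEigenvalue ζ k j)
      (Gamma (ζ / 2) * 2 ^ ((ζ : ℝ) + s - 2) / √π * Gamma (ζ / 2 + s - 1 / 2) *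
        (Gamma (k - s) / Gamma (k + s + ζ - 1))) := by
  have gauss := (hasSum_gauss (a := (k - s) / 2) (b := (k - s) / 2 + 1 / 2) (c := k + ζ / 2)
    (by linarith) (by linarith) (by linarith)).mul_left (Gamma (ζ / 2) * 2 ^ (-s - 1) / √π)
  simp only [Gamma_sub_div_factorial_mul_powEigenvalue hζ]
  convert! gauss using 1
  have duplication₁ := Real.Gamma_mul_Gamma_add_half ((k - s) / 2)
  have duplication₂ := Real.Gamma_mul_Gamma_add_half ((k + s + ζ - 1) / 2)
  rw [show 2 * ((k - s) / 2) = k - s by ring] at duplication₁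
  rw [show 2 * ((k + s + ζ - 1 : ℝ) / 2) = k + s + ζ - 1 by ring, mul_comm] at duplication₂
  rw [show k + ζ / 2 - (k - s) / 2 - ((k - s) / 2 + 1 / 2) = ζ / 2 + s - 1 / 2 by ring,
    show k + ζ / 2 - (k - s) / 2 = (k + s + ζ - 1) / 2 + 1 / 2 by ring,
    show k + ζ / 2 - ((k - s) / 2 + 1 / 2) = (k + s + ζ - 1) / 2 by ring,
    duplication₁, duplication₂]
  have : Gamma (k + s + ζ - 1) ≠ 0 := (Gamma_pos_of_pos (by linarith)).ne'
  have hpow : (2 : ℝ) ^ ((ζ : ℝ) + s - 2) * 2 ^ (1 - (k + s + ζ - 1 : ℝ)) =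
      2 ^ (-s - 1) * 2 ^ (1 - (k - s) : ℝ) := by
    rw [← rpow_add two_pos, ← rpow_add two_pos]
    congr 1
    ring
  have hpow_ne : (2 : ℝ) ^ (1 - (k + s + ζ - 1 : ℝ)) ≠ 0 := (rpow_pos_of_pos two_pos _).ne'
  rw [eq_div_of_mul_eq hpow_ne hpow]
  generalize (2 : ℝ) ^ (1 - (k + s + ζ - 1 : ℝ)) = p at hpow_ne ⊢
  generalize (2 : ℝ) ^ (-s - 1) = q, (2 : ℝ) ^ (1 - (k - s) : ℝ) = r
  field_simp

lemma isEquivalent_tsum_mul {u v : ℕ → ℝ} (huv : u ~[atTop] v) (hv : ∀ᶠ m in atTop, 0 ≤ v m)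
    {φ : ℕ → ℕ → ℕ} (hφ : ∀ k j, k ≤ φ k j) {w : ℕ → ℕ → ℝ} (hw : ∀ k j, 0 ≤ w k j)
    (hsum : ∀ᶠ k in atTop, Summable fun j => v (φ k j) * w k j) :
    (fun k => ∑' j, u (φ k j) * w k j) ~[atTop] fun k => ∑' j, v (φ k j) * w k j := by
  refine Asymptotics.isLittleO_iff.2 fun ε hε => ?_
  obtain ⟨N, hN⟩ := eventually_atTop.1 ((huv.isLittleO.def hε).and hv)
  filter_upwards [eventually_ge_atTop N, hsum] with k hk hk_sum
  have hterm (j : ℕ) : ‖u (φ k j) * w k j - v (φ k j) * w k j‖ ≤ ε * (v (φ k j) * w k j) := by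
    obtain ⟨h, hv⟩ := hN (φ k j) (hk.trans (hφ k j))
    rw [Pi.sub_apply, Real.norm_of_nonneg hv] at h
    rw [← sub_mul, norm_mul, Real.norm_of_nonneg (hw k j), ← mul_assoc]
    exact mul_le_mul_of_nonneg_right h (hw k j)
  have hsub := Summable.of_norm_bounded (hk_sum.mul_left ε) hterm
  have hu_sum : Summable fun j => u (φ k j) * w k j := by simpa using hsub.add hk_sum
  rw [Pi.sub_apply, ← hu_sum.tsum_sub hk_sum]
  calc ‖∑' j, (u (φ k j) * w k j - v (φ k j) * w k j)‖
      ≤ ε * ∑' j, v (φ k j) * w k j := tsum_of_norm_bounded (hk_sum.hasSum.mul_left ε) hterm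
    _ ≤ ε * ‖∑' j, v (φ k j) * w k j‖ := by gcongr; exact le_abs_self _

theorem exists_isEquivalent_dotEigenvalue {ν : ℝ} (hζ : 0 < ζ) (hν : 3 < ζ + 2 * ν)
    {ρ : ℕ → ℝ} {c : ℝ} (hc : 0 < c) (hρ : ρ ~[atTop] fun m : ℕ => c * (m : ℝ) ^ (-ν)) :
    ∃ c' : ℝ, 0 < c' ∧
      dotEigenvalue ζ ρ ~[atTop] fun k : ℕ => c' * (k : ℝ) ^ (-(ζ + 2 * ν - 3)) := by
  set s : ℝ := ν - 1 with hs
  set σ : ℕ → ℝ := fun m => Gamma (m - s) / m.factorial with hσ_def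
  set D : ℝ := Gamma (ζ / 2) * 2 ^ ((ζ : ℝ) + s - 2) / √π * Gamma (ζ / 2 + s - 1 / 2)
  have hD : 0 < D := by
    have : 0 < (ζ : ℝ) / 2 + s - 1 / 2 := by linarith
    positivity
  have hσ : σ ~[atTop] fun m : ℕ => (m : ℝ) ^ (-ν) := by
    refine ((isEquivalent_Gamma_div_Gamma (-s) 1).congr_left ?_).congr_right ?_
    · exact .of_forall fun m => by simp only [hσ_def, sub_eq_add_neg, Gamma_nat_eq_factorial]
    · exact .of_forall fun m => by rw [hs, neg_sub, sub_sub_cancel_left]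
  have hσ_nonneg : ∀ᶠ m in atTop, 0 ≤ σ m :=
    hσ.eventually_nonneg (.of_forall fun m => by positivity)
  have closed_form : ∀ᶠ k : ℕ in atTop, HasSum (fun j => c * σ (k + 2 * j) * powEigenvalue ζ k j)
      (c * (D * (Gamma (k - s) / Gamma (k + s + ζ - 1)))) := by
    filter_upwards [tendsto_natCast_atTop_atTop.eventually_gt_atTop s] with k hk
    refine ((hasSum_Gamma_sub_div_factorial_mul_powEigenvalue hζ
      (by linarith) hk).mul_left c).congr_fun fun j => ?_
    ring
  have to_closed_form : dotEigenvalue ζ ρ ~[atTop]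
      fun k : ℕ => c * (D * (Gamma (k - s) / Gamma (k + s + ζ - 1))) := by
    refine (isEquivalent_tsum_mul (φ := fun k j => k + 2 * j) (w := powEigenvalue ζ)
      (hρ.trans (Asymptotics.IsEquivalent.refl.mul hσ.symm)) ?_ (fun k j => by omega)
      (fun k j => (powEigenvalue_pos hζ k j).le) ?_).congr_right ?_
    · filter_upwards [hσ_nonneg] with m hm using mul_nonneg hc.le hm
    · filter_upwards [closed_form] with k hk using hk.summable
    · filter_upwards [closed_form] with k hk using hk.tsum_eq
  refine ⟨c * D, by positivity, to_closed_form.trans ?_⟩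
  have hratio := isEquivalent_Gamma_div_Gamma (-s) (s + ζ - 1)
  refine ((Asymptotics.IsEquivalent.refl (u := fun _ : ℕ => c * D)).mul hratio |>.congr_left
    ?_).congr_right ?_
  · exact .of_forall fun k => by
      simp only [Pi.mul_apply, mul_assoc, sub_eq_add_neg, add_assoc]
  · exact .of_forall fun k => by simp only [Pi.mul_apply, hs]; ring_nf

end DotProductEigenvalue

section PolarCoordinates

variable {E : Type*} [NormedAddCommGroup E] [NormedSpace ℝ E] [FiniteDimensional ℝ E]
  [Nontrivial E] [MeasurableSpace E] [BorelSpace E] (μ : Measure E) [μ.IsAddHaarMeasure]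

lemma integral_volumeIoiPow (n : ℕ) (g : ℝ → ℝ) :
    ∫ r : Ioi (0 : ℝ), g r ∂(.volumeIoiPow n) = ∫ r in Ioi (0 : ℝ), r ^ n * g r := by
  simp only [Measure.volumeIoiPow, ENNReal.ofReal]
  rw [integral_withDensity_eq_integral_smul (measurable_subtype_coe.pow_const _).real_toNNReal,
    integral_subtype_comap measurableSet_Ioi fun r : ℝ => Real.toNNReal (r ^ n) • g r]
  refine setIntegral_congr_fun measurableSet_Ioi fun r hr => ?_
  rw [NNReal.smul_def, Real.coe_toNNReal _ (pow_nonneg (le_of_lt hr) _), smul_eq_mul]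

theorem integral_mul_comp_norm_of_forall_smul {f : E → ℝ} {n : ℕ}
    (hf : ∀ (r : ℝ) (x : E), f (r • x) = r ^ n * f x) (g : ℝ → ℝ) :
    ∫ z, f z * g ‖z‖ ∂μ = (∫ x, f x ∂μ.toSphere) *
      ∫ r in Ioi (0 : ℝ), r ^ (n + Module.finrank ℝ E - 1) * g r := by
  have hdim : 0 < Module.finrank ℝ E := Module.finrank_pos
  let F : Metric.sphere (0 : E) 1 × Ioi (0 : ℝ) → ℝ := fun p => f p.1 * ((p.2 : ℝ) ^ n * g p.2)
  have hF (x : ({0}ᶜ : Set E)) : f x * g ‖x.1‖ = F (homeomorphUnitSphereProd E x) := by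
    have hx : ‖x.1‖ ≠ 0 := norm_ne_zero_iff.2 x.2
    simp only [F, homeomorphUnitSphereProd_apply_snd_coe, homeomorphUnitSphereProd_apply_fst_coe,
      hf, inv_pow]
    field_simp
  calc ∫ z, f z * g ‖z‖ ∂μ
      = ∫ x : ({0}ᶜ : Set E), f x * g ‖x.1‖ ∂(μ.comap (↑)) := by
        rw [integral_subtype_comap (measurableSet_singleton _).compl fun z : E => f z * g ‖z‖,
          restrict_compl_singleton]
    _ = ∫ p, F p ∂μ.toSphere.prod (.volumeIoiPow (Module.finrank ℝ E - 1)) := by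
        simp_rw [hF]
        exact μ.measurePreserving_homeomorphUnitSphereProd.integral_comp
          (Homeomorph.measurableEmbedding _) F
    _ = (∫ x, f x ∂μ.toSphere) *
          ∫ r : Ioi (0 : ℝ), (r : ℝ) ^ n * g r ∂(.volumeIoiPow (Module.finrank ℝ E - 1)) :=
        integral_prod_mul (fun x : Metric.sphere (0 : E) 1 => f x)
          fun r : Ioi (0 : ℝ) => (r : ℝ) ^ n * g r
    _ = _ := by
        rw [integral_volumeIoiPow _ fun r => r ^ n * g r]
        simp_rw [← mul_assoc, ← pow_add, Nat.add_comm _ n, ← Nat.add_sub_assoc hdim]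

end PolarCoordinates

section GaussianIntegral

open MvPolynomial

variable {ι : Type*}

lemma eval_smul_of_isHomogeneous {p : MvPolynomial ι ℝ} {n : ℕ} (hp : p.IsHomogeneous n)
    (a : ℝ) (v : ι → ℝ) : eval (a • v) p = a ^ n * eval v p := by
  rw [eval_eq, eval_eq, Finset.mul_sum]
  refine Finset.sum_congr rfl fun m hm => ?_
  simp only [Pi.smul_apply, smul_eq_mul, mul_pow, Finset.prod_mul_distrib,
    Finset.prod_pow_eq_pow_sum, ← hp.degree_eq_sum_deg_support hm]
  ring

lemma continuous_eval_ofLp (p : MvPolynomial ι ℝ) :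
    Continuous fun z : EuclideanSpace ℝ ι => eval z.ofLp p :=
  (MvPolynomial.continuous_eval p).comp (PiLp.continuous_ofLp 2 _)

lemma hasLineDerivAt_eval [DecidableEq ι] (p : MvPolynomial ι ℝ) (z : EuclideanSpace ℝ ι) (j : ι) :
    HasLineDerivAt ℝ (fun z : EuclideanSpace ℝ ι => eval z.ofLp p)
      (eval z.ofLp (pderiv j p)) z (EuclideanSpace.single j 1) := by
  unfold HasLineDerivAt
  induction p using MvPolynomial.induction_on with
  | C a => simpa using hasDerivAt_const (0 : ℝ) a
  | add p q hp hq =>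
    simp only [map_add]
    exact hp.add hq
  | mul_X p i hp =>
    have hX : HasDerivAt (fun t : ℝ => (z + t • EuclideanSpace.single j (1 : ℝ)).ofLp i)
        (if i = j then 1 else 0) 0 := by
      simpa using ((hasDerivAt_id (0 : ℝ)).mul_const (if i = j then (1 : ℝ) else 0)).const_add
        (z.ofLp i)
    simp only [map_mul, eval_X]
    refine (hp.mul hX).congr_deriv ?_
    rw [Derivation.leibniz, pderiv_X]
    rcases eq_or_ne i j with rfl | hij
    · simp [mul_comm, add_comm]
    · simp [hij, mul_comm]

variable [Fintype ι]

lemma exists_abs_eval_le (p : MvPolynomial ι ℝ) :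
    ∃ (C : ℝ) (n : ℕ), 0 ≤ C ∧ ∀ z : EuclideanSpace ℝ ι, |eval z.ofLp p| ≤ C * (1 + ‖z‖) ^ n := by
  induction p using MvPolynomial.induction_on with
  | C a => exact ⟨|a|, 0, abs_nonneg a, fun z => by simp⟩
  | add p q hp hq =>
    obtain ⟨C, n, hC, hp⟩ := hp
    obtain ⟨D, m, hD, hq⟩ := hq
    refine ⟨C + D, max n m, by positivity, fun z => ?_⟩
    have one_le : 1 ≤ 1 + ‖z‖ := le_add_of_nonneg_right (norm_nonneg z)
    calc |eval z.ofLp (p + q)| ≤ |eval z.ofLp p| + |eval z.ofLp q| := by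
          rw [map_add]; exact abs_add_le _ _
      _ ≤ C * (1 + ‖z‖) ^ n + D * (1 + ‖z‖) ^ m := add_le_add (hp z) (hq z)
      _ ≤ C * (1 + ‖z‖) ^ max n m + D * (1 + ‖z‖) ^ max n m := by
          gcongr <;> first | exact one_le | simp
      _ = (C + D) * (1 + ‖z‖) ^ max n m := (add_mul ..).symm
  | mul_X p j hp =>
    obtain ⟨C, n, hC, hp⟩ := hp
    refine ⟨C, n + 1, hC, fun z => ?_⟩
    have hj : |z.ofLp j| ≤ 1 + ‖z‖ := (PiLp.norm_apply_le z j).trans (by simp)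
    rw [map_mul, eval_X, abs_mul, pow_succ, ← mul_assoc]
    exact mul_le_mul (hp z) hj (abs_nonneg _) (by positivity)

lemma integrable_exp_neg_mul_sq_norm {V : Type*} [NormedAddCommGroup V] [InnerProductSpace ℝ V]
    [FiniteDimensional ℝ V] [MeasurableSpace V] [BorelSpace V] {b : ℝ} (hb : 0 < b) :
    Integrable fun z : V => exp (-b * ‖z‖ ^ 2) := by
  refine .of_integral_ne_zero ?_
  rw [GaussianFourier.integral_rexp_neg_mul_sq_norm hb]
  positivity

lemma integrable_eval_mul_exp (p : MvPolynomial ι ℝ) :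
    Integrable fun z : EuclideanSpace ℝ ι => eval z.ofLp p * exp (-‖z‖ ^ 2 / 2) := by
  obtain ⟨C, n, hC, hp⟩ := exists_abs_eval_le p
  refine ((integrable_exp_neg_mul_sq_norm (b := 1 / 4) (by norm_num)).const_mul
    (C * n.factorial * exp 2)).mono'
    ((continuous_eval_ofLp p).mul (by fun_prop)).aestronglyMeasurable (ae_of_all _ fun z => ?_)
  rw [norm_mul, Real.norm_eq_abs, Real.norm_of_nonneg (exp_pos _).le]
  have pow_le : (1 + ‖z‖) ^ n ≤ n.factorial * exp (1 + ‖z‖) :=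
    (div_le_iff₀' (by positivity)).1 (pow_div_factorial_le_exp (1 + ‖z‖) (by positivity) n)
  have exponent_le : 1 + ‖z‖ + -‖z‖ ^ 2 / 2 ≤ 2 + -(1 / 4) * ‖z‖ ^ 2 := by
    linarith [sq_nonneg (‖z‖ - 2)]
  calc |eval z.ofLp p| * exp (-‖z‖ ^ 2 / 2)
      ≤ C * (n.factorial * exp (1 + ‖z‖)) * exp (-‖z‖ ^ 2 / 2) := by
        gcongr; exact (hp z).trans (by gcongr)
    _ = C * n.factorial * exp (1 + ‖z‖ + -‖z‖ ^ 2 / 2) := by rw [exp_add _ (-‖z‖ ^ 2 / 2)]; ring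
    _ ≤ C * n.factorial * exp (2 + -(1 / 4) * ‖z‖ ^ 2) := by gcongr
    _ = C * n.factorial * exp 2 * exp (-(1 / 4) * ‖z‖ ^ 2) := by rw [exp_add, ← mul_assoc]

/-- The integral of a polynomial against the (unnormalized) standard Gaussian weight. -/
def gaussInt : MvPolynomial ι ℝ →ₗ[ℝ] ℝ where
  toFun p := ∫ z : EuclideanSpace ℝ ι, eval z.ofLp p * exp (-‖z‖ ^ 2 / 2)
  map_add' p q := by
    simp only [map_add, add_mul]
    exact integral_add (integrable_eval_mul_exp p) (integrable_eval_mul_exp q)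
  map_smul' a p := by
    simp only [smul_eval, mul_assoc, integral_const_mul, RingHom.id_apply, smul_eq_mul]

lemma gaussInt_apply (p : MvPolynomial ι ℝ) :
    gaussInt p = ∫ z : EuclideanSpace ℝ ι, eval z.ofLp p * exp (-‖z‖ ^ 2 / 2) := rfl

lemma hasLineDerivAt_exp_neg_sq_norm [DecidableEq ι] (z : EuclideanSpace ℝ ι) (j : ι) :
    HasLineDerivAt ℝ (fun z : EuclideanSpace ℝ ι => exp (-‖z‖ ^ 2 / 2))
      (-(z.ofLp j * exp (-‖z‖ ^ 2 / 2))) z (EuclideanSpace.single j 1) := by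
  have hsq := ((hasStrictFDerivAt_norm_sq z).hasFDerivAt.hasLineDerivAt
    (EuclideanSpace.single j (1 : ℝ)))
  unfold HasLineDerivAt at hsq ⊢
  refine (hsq.neg.div_const 2).exp.congr_deriv ?_
  simp [EuclideanSpace.inner_single_right]
  ring

lemma gaussInt_pderiv (p : MvPolynomial ι ℝ) (j : ι) :
    gaussInt (pderiv j p) = gaussInt (X j * p) := by
  classical
  have hXp (z : EuclideanSpace ℝ ι) : eval z.ofLp p * -(z.ofLp j * exp (-‖z‖ ^ 2 / 2)) =
      -(eval z.ofLp (X j * p) * exp (-‖z‖ ^ 2 / 2)) := by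
    rw [map_mul, eval_X]; ring
  have by_parts := integral_bilinear_hasLineDerivAt_right_eq_neg_left_of_integrable
    (μ := (volume : Measure (EuclideanSpace ℝ ι)))
    (f := fun z => eval z.ofLp p) (f' := fun z => eval z.ofLp (pderiv j p))
    (g := fun z => exp (-‖z‖ ^ 2 / 2)) (g' := fun z => -(z.ofLp j * exp (-‖z‖ ^ 2 / 2)))
    (v := EuclideanSpace.single j 1) (B := ContinuousLinearMap.mul ℝ ℝ)
    (integrable_eval_mul_exp _)
    (by simp only [ContinuousLinearMap.mul_apply', hXp]; exact (integrable_eval_mul_exp _).neg)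
    (integrable_eval_mul_exp _)
    (fun z _ => hasLineDerivAt_eval p z j) (fun z _ => hasLineDerivAt_exp_neg_sq_norm z j)
  simp only [ContinuousLinearMap.mul_apply', hXp, integral_neg, neg_inj] at by_parts
  exact by_parts.symm

end GaussianIntegral

section RadialMoment

/-- The `n`-th moment of the (unnormalized) standard Gaussian weight on the half-line, the radial
factor of Gaussian integrals in polar coordinates. -/
def radialMoment (n : ℕ) : ℝ := ∫ r in Ioi (0 : ℝ), r ^ n * exp (-r ^ 2 / 2)

lemma radialMoment_eq_Gamma (n : ℕ) :
    radialMoment n = (1 / 2) ^ (-(n + 1 : ℝ) / 2) * (1 / 2) * Gamma ((n + 1) / 2) := by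
  have hn : (-1 : ℝ) < n := by linarith [n.cast_nonneg (α := ℝ)]
  rw [← integral_rpow_mul_exp_neg_mul_rpow two_pos hn (by norm_num : (0 : ℝ) < 1 / 2), radialMoment]
  refine integral_congr_ae (.of_forall fun r => ?_)
  simp only [rpow_natCast, rpow_two]
  ring_nf

lemma radialMoment_pos (n : ℕ) : 0 < radialMoment n := by
  rw [radialMoment_eq_Gamma]
  positivity

lemma radialMoment_add_two (n : ℕ) : radialMoment (n + 2) = (n + 1) * radialMoment n := by
  have hpos : (0 : ℝ) < (n + 1) / 2 := by positivity
  have hGamma : Gamma (((n + 2 : ℕ) + 1 : ℝ) / 2) = (n + 1) / 2 * Gamma ((n + 1) / 2) := by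
    rw [← Gamma_add_one hpos.ne']
    push_cast
    ring_nf
  have hpow : (1 / 2 : ℝ) ^ (-((n + 2 : ℕ) + 1 : ℝ) / 2) = 2 * (1 / 2) ^ (-(n + 1 : ℝ) / 2) := by
    rw [show -((n + 2 : ℕ) + 1 : ℝ) / 2 = -(n + 1 : ℝ) / 2 + -1 by push_cast; ring,
      rpow_add (by norm_num), rpow_neg_one]
    ring
  rw [radialMoment_eq_Gamma, radialMoment_eq_Gamma, hGamma, hpow]
  ring

end RadialMoment

section SphereIntegral

open MvPolynomial

lemma integrable_continuousMap {X : Type*} [TopologicalSpace X] [CompactSpace X]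
    [MeasurableSpace X] [OpensMeasurableSpace X] (μ : Measure X) [IsFiniteMeasure μ] (f : C(X, ℝ)) :
    Integrable f μ :=
  f.continuous.integrable_of_hasCompactSupport (.of_compactSpace _)

variable {ζ : ℕ}

lemma toSphere_real_univ_pos (hζ : 0 < ζ) :
    0 < (volume : Measure (EuclideanSpace ℝ (Fin ζ))).toSphere.real univ := by
  have : Nonempty (Fin ζ) := ⟨⟨0, hζ⟩⟩
  exact ENNReal.toReal_pos (Measure.measure_univ_ne_zero.2 (Measure.toSphere_ne_zero _))
    (measure_ne_top _ _)

lemma isProbabilityMeasure_unifSph (hζ : 0 < ζ) : IsProbabilityMeasure (unifSph ζ) := by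
  have : Nonempty (Fin ζ) := ⟨⟨0, hζ⟩⟩
  exact ProbabilityTheory.cond_isProbabilityMeasure
    (Measure.measure_univ_ne_zero.2 (Measure.toSphere_ne_zero _))

lemma integral_toSphere (hζ : 0 < ζ) (f : Sph ζ → ℝ) :
    ∫ x, f x ∂(volume : Measure (EuclideanSpace ℝ (Fin ζ))).toSphere =
      (volume : Measure (EuclideanSpace ℝ (Fin ζ))).toSphere.real univ *
        ∫ x, f x ∂(unifSph ζ) := by
  simp only [unifSph, ProbabilityTheory.cond, Measure.restrict_univ, integral_smul_measure,
    smul_eq_mul, ENNReal.toReal_inv]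
  rw [← Measure.real, mul_inv_cancel_left₀ (toSphere_real_univ_pos hζ).ne']

lemma restrictSph_apply (p : MvPolynomial (Fin ζ) ℝ) (x : Sph ζ) :
    restrictSph ζ p x = eval (x : EuclideanSpace ℝ (Fin ζ)).ofLp p := by
  induction p using MvPolynomial.induction_on with
  | C a => simp [restrictSph]
  | add p q hp hq => simp [hp, hq]
  | mul_X p i hp => rw [map_mul, ContinuousMap.mul_apply, hp, map_mul]; simp [restrictSph, coord]

/-- Integration over the sphere, as a functional on polynomials. -/
def sphInt (ζ : ℕ) : MvPolynomial (Fin ζ) ℝ →ₗ[ℝ] ℝ where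
  toFun p := ∫ x, restrictSph ζ p x ∂(unifSph ζ)
  map_add' p q := by
    simp only [map_add, ContinuousMap.add_apply]
    exact integral_add (integrable_continuousMap _ _) (integrable_continuousMap _ _)
  map_smul' a p := by
    simp only [map_smul, ContinuousMap.smul_apply, integral_smul, RingHom.id_apply]

lemma sphInt_apply (p : MvPolynomial (Fin ζ) ℝ) :
    sphInt ζ p = ∫ x, restrictSph ζ p x ∂(unifSph ζ) := rfl

lemma gaussInt_eq_mul_sphInt (hζ : 0 < ζ) {p : MvPolynomial (Fin ζ) ℝ} {n : ℕ}
    (hp : p.IsHomogeneous n) :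
    gaussInt p = (volume : Measure (EuclideanSpace ℝ (Fin ζ))).toSphere.real univ *
      radialMoment (n + ζ - 1) * sphInt ζ p := by
  have : Nonempty (Fin ζ) := ⟨⟨0, hζ⟩⟩
  have hsmul (r : ℝ) (z : EuclideanSpace ℝ (Fin ζ)) :
      eval (r • z).ofLp p = r ^ n * eval z.ofLp p := eval_smul_of_isHomogeneous hp r z.ofLp
  rw [gaussInt_apply, integral_mul_comp_norm_of_forall_smul volume hsmul
    fun r => exp (-r ^ 2 / 2), integral_toSphere hζ, finrank_euclideanSpace_fin, sphInt_apply,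
    radialMoment]
  simp_rw [restrictSph_apply]
  ring

lemma sphInt_eq_zero_iff (hζ : 0 < ζ) {p : MvPolynomial (Fin ζ) ℝ} {n : ℕ}
    (hp : p.IsHomogeneous n) : sphInt ζ p = 0 ↔ gaussInt p = 0 := by
  rw [gaussInt_eq_mul_sphInt hζ hp, mul_eq_zero_iff_left
    (mul_pos (toSphere_real_univ_pos hζ) (radialMoment_pos _)).ne']

end SphereIntegral

section Laplacian

open MvPolynomial

variable {ζ : ℕ}

lemma polyLaplacian_apply (p : MvPolynomial (Fin ζ) ℝ) :
    polyLaplacian ζ p = ∑ j, pderiv j (pderiv j p) := by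
  simp [polyLaplacian]

lemma pderiv_pderiv_comm {R ι : Type*} [CommRing R] (i j : ι) (p : MvPolynomial ι R) :
    pderiv i (pderiv j p) = pderiv j (pderiv i p) := by
  classical
  have hcomm : ⁅pderiv (R := R) i, pderiv (R := R) j⁆ = 0 :=
    MvPolynomial.derivation_ext fun k => by
      simp [Derivation.commutator_apply, pderiv_X, Pi.single_apply, apply_ite]
  rw [← sub_eq_zero, ← Derivation.commutator_apply, hcomm, Derivation.zero_apply]

lemma pderiv_eq_zero_of_isHomogeneous_zero {R ι : Type*} [CommSemiring R] {p : MvPolynomial ι R}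
    (hp : p.IsHomogeneous 0) (j : ι) : pderiv j p = 0 := by
  rw [← totalDegree_zero_iff_isHomogeneous, totalDegree_eq_zero_iff_eq_C] at hp
  rw [hp, pderiv_C]

lemma isHomogeneous_polyLaplacian {p : MvPolynomial (Fin ζ) ℝ} {n : ℕ} (hp : p.IsHomogeneous n) :
    (polyLaplacian ζ p).IsHomogeneous (n - 2) := by
  rw [polyLaplacian_apply]
  exact IsHomogeneous.sum _ _ _ fun j _ => hp.pderiv.pderiv

lemma polyLaplacian_eq_zero_of_isHomogeneous {p : MvPolynomial (Fin ζ) ℝ} {n : ℕ} (hn : n ≤ 1)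
    (hp : p.IsHomogeneous n) : polyLaplacian ζ p = 0 := by
  rw [polyLaplacian_apply]
  refine Finset.sum_eq_zero fun j _ => pderiv_eq_zero_of_isHomogeneous_zero ?_ j
  simpa only [Nat.sub_eq_zero_of_le hn] using hp.pderiv (i := j)

lemma polyLaplacian_pderiv (j : Fin ζ) (p : MvPolynomial (Fin ζ) ℝ) :
    polyLaplacian ζ (pderiv j p) = pderiv j (polyLaplacian ζ p) := by
  simp only [polyLaplacian_apply, map_sum]
  exact Finset.sum_congr rfl fun i _ => by rw [pderiv_pderiv_comm i j p, pderiv_pderiv_comm i j]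

lemma natCast_mul_gaussInt_mul {p : MvPolynomial (Fin ζ) ℝ} {n : ℕ} (hp : p.IsHomogeneous n)
    (q : MvPolynomial (Fin ζ) ℝ) :
    n * gaussInt (q * p) = gaussInt (q * polyLaplacian ζ p) +
      ∑ j, gaussInt (pderiv j q * pderiv j p) := by
  have euler : (n : ℝ) • (q * p) = ∑ j, X j * (q * pderiv j p) := by
    rw [← mul_smul_comm, Nat.cast_smul_eq_nsmul, ← hp.sum_X_mul_pderiv, Finset.mul_sum]
    exact Finset.sum_congr rfl fun j _ => mul_left_comm ..
  rw [← smul_eq_mul, ← map_smul, euler, map_sum, polyLaplacian_apply, Finset.mul_sum, map_sum,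
    ← Finset.sum_add_distrib]
  refine Finset.sum_congr rfl fun j _ => ?_
  rw [← gaussInt_pderiv, ← map_add, Derivation.leibniz, smul_eq_mul, smul_eq_mul,
    mul_comm (pderiv j p)]

lemma gaussInt_mul_eq_zero {m n : ℕ} (hmn : m < n) {q p : MvPolynomial (Fin ζ) ℝ}
    (hq : q.IsHomogeneous m) (hp : p.IsHomogeneous n) (hΔ : polyLaplacian ζ p = 0) :
    gaussInt (q * p) = 0 := by
  have hn : (n : ℝ) ≠ 0 := by exact_mod_cast (show n ≠ 0 by omega)
  refine (mul_eq_zero.1 ?_).resolve_left hn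
  rw [natCast_mul_gaussInt_mul hp, hΔ, mul_zero, map_zero, zero_add]
  refine Finset.sum_eq_zero fun j _ => ?_
  rcases m with _ | m
  · rw [pderiv_eq_zero_of_isHomogeneous_zero hq, zero_mul, map_zero]
  · exact gaussInt_mul_eq_zero (by omega) hq.pderiv (hp.pderiv (i := j))
      (by rw [polyLaplacian_pderiv, hΔ, map_zero])

theorem natCast_mul_sphInt_eq_sphInt_polyLaplacian (hζ : 0 < ζ) {p : MvPolynomial (Fin ζ) ℝ}
    {n : ℕ} (hp : p.IsHomogeneous n) :
    n * (n + ζ - 2) * sphInt ζ p = sphInt ζ (polyLaplacian ζ p) := by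
  have green : n * gaussInt p = gaussInt (polyLaplacian ζ p) := by
    simpa only [one_mul, pderiv_one, zero_mul, map_zero, Finset.sum_const_zero, add_zero] using
      natCast_mul_gaussInt_mul hp 1
  rcases n with _ | _ | n
  · simp [polyLaplacian_eq_zero_of_isHomogeneous zero_le_one hp]
  · rw [polyLaplacian_eq_zero_of_isHomogeneous le_rfl hp, map_zero] at green ⊢
    have : gaussInt p = 0 := by simpa using green
    rw [(sphInt_eq_zero_iff hζ hp).2 this, mul_zero]
  · have hne := (mul_pos (toSphere_real_univ_pos hζ) (radialMoment_pos (n + ζ - 1))).ne'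
    have hmoment : radialMoment (n + 2 + ζ - 1) = (n + ζ) * radialMoment (n + ζ - 1) := by
      rw [show n + 2 + ζ - 1 = n + ζ - 1 + 2 by omega, radialMoment_add_two,
        Nat.cast_sub (by omega)]
      push_cast
      ring
    rw [gaussInt_eq_mul_sphInt hζ hp, hmoment,
      gaussInt_eq_mul_sphInt hζ (isHomogeneous_polyLaplacian hp),
      show n + 1 + 1 - 2 = n from rfl] at green
    refine mul_left_cancel₀ hne ?_
    rw [← green]
    push_cast
    ring

end Laplacian

section LinearForm

open MvPolynomial

variable {ζ : ℕ}

/-- The linear form `z ↦ ⟨v, z⟩`, as a polynomial. -/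
def linForm (v : Fin ζ → ℝ) : MvPolynomial (Fin ζ) ℝ := ∑ j, C (v j) * X j

/-- The derivative of a polynomial in the direction `v`. -/
def dirDeriv (v : Fin ζ → ℝ) (p : MvPolynomial (Fin ζ) ℝ) : MvPolynomial (Fin ζ) ℝ :=
  ∑ j, C (v j) * pderiv j p

lemma isHomogeneous_linForm (v : Fin ζ → ℝ) : (linForm v).IsHomogeneous 1 :=
  .sum _ _ _ fun j _ => isHomogeneous_C_mul_X (v j) j

lemma pderiv_linForm (v : Fin ζ → ℝ) (j : Fin ζ) : pderiv j (linForm v) = C (v j) := by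
  simp [linForm, Derivation.leibniz, pderiv_X, Pi.single_apply]

lemma isHomogeneous_dirDeriv {p : MvPolynomial (Fin ζ) ℝ} {n : ℕ} (hp : p.IsHomogeneous n)
    (v : Fin ζ → ℝ) : (dirDeriv v p).IsHomogeneous (n - 1) :=
  .sum _ _ _ fun j _ => hp.pderiv.C_mul (v j)

lemma dirDeriv_eq_zero_of_isHomogeneous_zero {p : MvPolynomial (Fin ζ) ℝ}
    (hp : p.IsHomogeneous 0) (v : Fin ζ → ℝ) : dirDeriv v p = 0 :=
  Finset.sum_eq_zero fun j _ => by rw [pderiv_eq_zero_of_isHomogeneous_zero hp, mul_zero]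

lemma polyLaplacian_dirDeriv_eq_zero {p : MvPolynomial (Fin ζ) ℝ} (hΔ : polyLaplacian ζ p = 0)
    (v : Fin ζ → ℝ) : polyLaplacian ζ (dirDeriv v p) = 0 := by
  simp only [dirDeriv, map_sum, ← smul_eq_C_mul, map_smul, polyLaplacian_pderiv, hΔ, map_zero,
    smul_zero, Finset.sum_const_zero]

lemma eval_dirDeriv_self {p : MvPolynomial (Fin ζ) ℝ} {n : ℕ} (hp : p.IsHomogeneous n)
    (v : Fin ζ → ℝ) : eval v (dirDeriv v p) = n * eval v p := by
  simpa [dirDeriv] using congrArg (eval v) hp.sum_X_mul_pderiv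

lemma polyLaplacian_linForm_pow_mul (v : Fin ζ → ℝ) (m : ℕ) (p : MvPolynomial (Fin ζ) ℝ) :
    polyLaplacian ζ (linForm v ^ m * p) =
      (m * (m - 1 : ℕ) * ∑ j, v j ^ 2 : ℝ) • (linForm v ^ (m - 2) * p) +
        (2 * m : ℝ) • (linForm v ^ (m - 1) * dirDeriv v p) +
        linForm v ^ m * polyLaplacian ζ p := by
  have hterm (j : Fin ζ) : pderiv j (pderiv j (linForm v ^ m * p)) =
      (m * (m - 1 : ℕ) * v j ^ 2 : ℝ) • (linForm v ^ (m - 2) * p) +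
        (2 * m : ℝ) • (linForm v ^ (m - 1) * (C (v j) * pderiv j p)) +
        linForm v ^ m * pderiv j (pderiv j p) := by
    simp only [Derivation.leibniz, Derivation.leibniz_pow, smul_eq_mul, map_add, pderiv_linForm,
      smul_eq_C_mul, nsmul_eq_mul, map_mul, map_pow, map_natCast, map_ofNat, pderiv_C, mul_zero,
      Derivation.map_natCast, Nat.sub_sub]
    ring
  simp only [polyLaplacian_apply, hterm, Finset.sum_add_distrib, ← Finset.sum_smul,
    ← Finset.smul_sum, ← Finset.mul_sum, dirDeriv]

lemma sphInt_eq_eval_of_isHomogeneous_zero (hζ : 0 < ζ) {p : MvPolynomial (Fin ζ) ℝ}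
    (hp : p.IsHomogeneous 0) (v : Fin ζ → ℝ) : sphInt ζ p = eval v p := by
  have := isProbabilityMeasure_unifSph hζ
  rw [← totalDegree_zero_iff_isHomogeneous, totalDegree_eq_zero_iff_eq_C] at hp
  rw [hp]
  simp [sphInt_apply]

lemma mul_sphInt_linForm_pow_mul {v : Fin ζ → ℝ} (hv : ∑ j, v j ^ 2 = 1) (hζ : 0 < ζ) (m : ℕ)
    {k : ℕ} {p : MvPolynomial (Fin ζ) ℝ} (hp : p.IsHomogeneous k) (hΔ : polyLaplacian ζ p = 0) :
    (m + k : ℝ) * (m + k + ζ - 2) * sphInt ζ (linForm v ^ m * p) =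
      m * (m - 1 : ℕ) * sphInt ζ (linForm v ^ (m - 2) * p) +
        2 * m * sphInt ζ (linForm v ^ (m - 1) * dirDeriv v p) := by
  have hhom : (linForm v ^ m * p).IsHomogeneous (m + k) := by
    simpa only [one_mul] using ((isHomogeneous_linForm v).pow m).mul hp
  simpa [polyLaplacian_linForm_pow_mul, hv, hΔ] using
    natCast_mul_sphInt_eq_sphInt_polyLaplacian hζ hhom

lemma sphInt_linForm_pow_mul_eq_zero {v : Fin ζ → ℝ} (hv : ∑ j, v j ^ 2 = 1) (hζ : 2 ≤ ζ)
    {m k : ℕ} (hmk : ∀ j, m ≠ k + 2 * j) {p : MvPolynomial (Fin ζ) ℝ}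
    (hp : p.IsHomogeneous k) (hΔ : polyLaplacian ζ p = 0) :
    sphInt ζ (linForm v ^ m * p) = 0 := by
  induction hN : m + k using Nat.strong_induction_on generalizing m k p with
  | _ N ih =>
  subst hN
  have second_order : (m * (m - 1 : ℕ) : ℝ) * sphInt ζ (linForm v ^ (m - 2) * p) = 0 := by
    rcases m with _ | _ | m
    · simp
    · simp
    · rw [show m + 1 + 1 - 2 = m from rfl,
        ih (m + k) (by omega) (fun j hj => hmk (j + 1) (by omega)) hp hΔ rfl, mul_zero]
  have first_order : (2 * m : ℝ) * sphInt ζ (linForm v ^ (m - 1) * dirDeriv v p) = 0 := by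
    rcases k with _ | k
    · simp [dirDeriv_eq_zero_of_isHomogeneous_zero hp]
    rcases m with _ | m
    · simp
    · rw [show m + 1 - 1 = m from rfl, ih (m + k) (by omega) (fun j hj => hmk j (by omega))
        (isHomogeneous_dirDeriv hp v) (polyLaplacian_dirDeriv_eq_zero hΔ v) rfl, mul_zero]
  have recursion := mul_sphInt_linForm_pow_mul hv (by omega) m hp hΔ
  rw [second_order, first_order, add_zero] at recursion
  have hpos : (0 : ℝ) < m + k := by
    have : m + k ≠ 0 := fun h => hmk 0 (by omega)
    exact_mod_cast this.bot_lt
  have : (2 : ℝ) ≤ ζ := by exact_mod_cast hζ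
  exact (mul_eq_zero.1 recursion).resolve_left (mul_pos hpos (by linarith)).ne'

theorem sphInt_linForm_pow_mul {v : Fin ζ → ℝ} (hv : ∑ j, v j ^ 2 = 1) (hζ : 2 ≤ ζ)
    (k j : ℕ) {p : MvPolynomial (Fin ζ) ℝ} (hp : p.IsHomogeneous k) (hΔ : polyLaplacian ζ p = 0) :
    sphInt ζ (linForm v ^ (k + 2 * j) * p) = powEigenvalue ζ k j * eval v p := by
  have hζ_pos : 0 < ζ := by omega
  have hζ_two : (2 : ℝ) ≤ ζ := by exact_mod_cast hζ
  induction hN : k + j using Nat.strong_induction_on generalizing k j p with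
  | _ N ih =>
  subst hN
  rcases Nat.eq_zero_or_pos (k + j) with h0 | hpos
  · obtain ⟨rfl, rfl⟩ : k = 0 ∧ j = 0 := by omega
    rw [mul_zero, add_zero, pow_zero, one_mul, powEigenvalue_zero_zero hζ_pos, one_mul,
      sphInt_eq_eval_of_isHomogeneous_zero hζ_pos hp]
  have second_order : ((k + 2 * j : ℕ) * (k + 2 * j - 1 : ℕ) : ℝ) *
      sphInt ζ (linForm v ^ (k + 2 * j - 2) * p) =
        4 * j * (k + j - 1 + ζ / 2) * powEigenvalue ζ k j * eval v p := by
    rcases j with _ | j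
    · rcases k with _ | _ | k
      · simp
      · simp
      · rw [sphInt_linForm_pow_mul_eq_zero hv hζ (fun i => by omega) hp hΔ]; simp
    · rw [show k + 2 * (j + 1) - 2 = k + 2 * j by omega,
        show k + 2 * (j + 1) - 1 = k + 2 * j + 1 by omega, ih (k + j) (by omega) k j hp hΔ rfl]
      push_cast
      linear_combination eval v p * powEigenvalue_succ_right hζ_pos k j
  have first_order : (2 * (k + 2 * j : ℕ) : ℝ) *
      sphInt ζ (linForm v ^ (k + 2 * j - 1) * dirDeriv v p) =
        4 * k * (k + j - 1 + ζ / 2) * powEigenvalue ζ k j * eval v p := by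
    rcases k with _ | k
    · simp [dirDeriv_eq_zero_of_isHomogeneous_zero hp]
    · rw [show k + 1 + 2 * j - 1 = k + 2 * j by omega, ih (k + j) (by omega) k j
        (isHomogeneous_dirDeriv hp v) (polyLaplacian_dirDeriv_eq_zero hΔ v) rfl,
        eval_dirDeriv_self hp]
      push_cast
      linear_combination 2 * (k + 1) * eval v p * powEigenvalue_succ_left hζ_pos k j
  have recursion := mul_sphInt_linForm_pow_mul hv hζ_pos (k + 2 * j) hp hΔ
  rw [second_order, first_order] at recursion
  have one_le : (1 : ℝ) ≤ k + j := by exact_mod_cast hpos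
  refine mul_left_cancel₀ (a := ((k + j) * (4 * (k + j - 1 + ζ / 2)) : ℝ))
    (mul_pos (by linarith) (by linarith)).ne' ?_
  push_cast at recursion
  linear_combination recursion

end LinearForm

section SphericalHarmonics

open MvPolynomial

variable {ζ : ℕ}

/-- The polynomial `|z|²`, which restricts to `1` on the sphere. -/
def sqNorm (ζ : ℕ) : MvPolynomial (Fin ζ) ℝ := ∑ j, X j ^ 2

lemma isHomogeneous_sqNorm : (sqNorm ζ).IsHomogeneous 2 :=
  .sum _ _ _ fun j _ => isHomogeneous_X_pow j 2

lemma sum_sq_eq_one (x : Sph ζ) : ∑ j, (x : EuclideanSpace ℝ (Fin ζ)).ofLp j ^ 2 = 1 := by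
  rw [← EuclideanSpace.real_norm_sq_eq, norm_eq_of_mem_sphere, one_pow]

lemma restrictSph_sqNorm : restrictSph ζ (sqNorm ζ) = 1 := by
  ext x
  simpa [restrictSph_apply, sqNorm] using sum_sq_eq_one x

lemma eq_zero_of_gaussInt_mul_self {ι : Type*} [Fintype ι] {q : MvPolynomial ι ℝ}
    (h : gaussInt (q * q) = 0) : q = 0 := by
  have hnonneg (z : EuclideanSpace ℝ ι) :
      0 ≤ eval z.ofLp (q * q) * exp (-‖z‖ ^ 2 / 2) :=
    mul_nonneg (by rw [map_mul]; exact mul_self_nonneg _) (exp_pos _).le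
  rw [gaussInt_apply, integral_eq_zero_iff_of_nonneg hnonneg (integrable_eval_mul_exp _)] at h
  have hzero := (Continuous.ae_eq_iff_eq volume
    ((continuous_eval_ofLp (q * q)).mul (by fun_prop)) continuous_const).1 h
  refine MvPolynomial.funext fun v => ?_
  have hv : eval v (q * q) * exp (-‖WithLp.toLp 2 v‖ ^ 2 / 2) = 0 :=
    congrFun hzero (WithLp.toLp 2 v)
  simpa [(exp_pos _).ne'] using hv

lemma eq_zero_of_polyLaplacian_sqNorm_mul (hζ : 0 < ζ) {q : MvPolynomial (Fin ζ) ℝ} {m : ℕ}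
    (hq : q.IsHomogeneous m) (h : polyLaplacian ζ (sqNorm ζ * q) = 0) : q = 0 := by
  have hsq : (sqNorm ζ * q).IsHomogeneous (2 + m) := isHomogeneous_sqNorm.mul hq
  have orthogonal : sphInt ζ (q * (sqNorm ζ * q)) = 0 :=
    (sphInt_eq_zero_iff hζ (hq.mul hsq)).2 (gaussInt_mul_eq_zero (by omega) hq hsq h)
  refine eq_zero_of_gaussInt_mul_self ((sphInt_eq_zero_iff hζ (hq.mul hq)).1 ?_)
  simpa [sphInt_apply, restrictSph_sqNorm] using orthogonal

lemma exists_polyLaplacian_sqNorm_mul_eq (hζ : 0 < ζ) {p : MvPolynomial (Fin ζ) ℝ} {m : ℕ}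
    (hp : p.IsHomogeneous m) :
    ∃ q : MvPolynomial (Fin ζ) ℝ, q.IsHomogeneous m ∧ polyLaplacian ζ (sqNorm ζ * q) = p := by
  let V := homogeneousSubmodule (Fin ζ) ℝ m
  let L := polyLaplacian ζ ∘ₗ LinearMap.mulLeft ℝ (sqNorm ζ)
  have : Module.Finite ℝ V := Module.Finite.iff_fg.2 (homogeneousSubmodule_fg ..)
  have maps (q : MvPolynomial (Fin ζ) ℝ) (hq : q ∈ V) : L q ∈ V := by
    have := isHomogeneous_polyLaplacian (isHomogeneous_sqNorm.mul hq)
    rwa [Nat.add_sub_cancel_left] at this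
  have injective : Function.Injective (L.restrict maps) :=
    (injective_iff_map_eq_zero _).2 fun q hq =>
      Subtype.ext (eq_zero_of_polyLaplacian_sqNorm_mul hζ q.2 (congrArg Subtype.val hq))
  obtain ⟨q, hq⟩ := LinearMap.surjective_of_injective injective ⟨p, hp⟩
  exact ⟨q, q.2, congrArg Subtype.val hq⟩

instance finiteDimensional_sphHarm (k : ℕ) : FiniteDimensional ℝ (sphHarm ζ k) := by
  have : Module.Finite ℝ (homogeneousSubmodule (Fin ζ) ℝ k) :=
    Module.Finite.iff_fg.2 (homogeneousSubmodule_fg ..)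
  have : FiniteDimensional ℝ
      (homogeneousSubmodule (Fin ζ) ℝ k ⊓ LinearMap.ker (polyLaplacian ζ) : Submodule ℝ _) :=
    Submodule.finiteDimensional_of_le inf_le_left
  unfold sphHarm
  infer_instance

lemma restrictSph_mem_sphHarm {p : MvPolynomial (Fin ζ) ℝ} {n : ℕ} (hp : p.IsHomogeneous n)
    (hΔ : polyLaplacian ζ p = 0) : restrictSph ζ p ∈ sphHarm ζ n :=
  ⟨p, ⟨hp, hΔ⟩, rfl⟩

lemma restrictSph_mem_iSup_sphHarm_of_isHomogeneous (hζ : 0 < ζ) {p : MvPolynomial (Fin ζ) ℝ}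
    {n : ℕ} (hp : p.IsHomogeneous n) : restrictSph ζ p ∈ ⨆ k, sphHarm ζ k := by
  induction n using Nat.strong_induction_on generalizing p with
  | _ n ih =>
  by_cases hn : n ≤ 1
  · exact Submodule.mem_iSup_of_mem n
      (restrictSph_mem_sphHarm hp (polyLaplacian_eq_zero_of_isHomogeneous hn hp))
  obtain ⟨q, hq, hqp⟩ := exists_polyLaplacian_sqNorm_mul_eq hζ (isHomogeneous_polyLaplacian hp)
  have hsq : (sqNorm ζ * q).IsHomogeneous n := by
    simpa only [show 2 + (n - 2) = n by omega] using isHomogeneous_sqNorm.mul hq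
  have hsplit : restrictSph ζ p = restrictSph ζ (p - sqNorm ζ * q) + restrictSph ζ q := by
    simp [restrictSph_sqNorm]
  rw [hsplit]
  have harmonic : polyLaplacian ζ (p - sqNorm ζ * q) = 0 := by rw [map_sub, hqp, sub_self]
  exact add_mem (Submodule.mem_iSup_of_mem n (restrictSph_mem_sphHarm (hp.sub hsq) harmonic))
    (ih (n - 2) (by omega) hq)

theorem restrictSph_mem_iSup_sphHarm (hζ : 0 < ζ) (p : MvPolynomial (Fin ζ) ℝ) :
    restrictSph ζ p ∈ ⨆ k, sphHarm ζ k := by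
  rw [← sum_homogeneousComponent p, map_sum]
  exact sum_mem fun n _ =>
    restrictSph_mem_iSup_sphHarm_of_isHomogeneous hζ (homogeneousComponent_isHomogeneous n p)

theorem integral_mul_eq_zero_of_mem_sphHarm (hζ : 0 < ζ) {k l : ℕ} (hkl : k ≠ l) {f g : C(Sph ζ, ℝ)}
    (hf : f ∈ sphHarm ζ k) (hg : g ∈ sphHarm ζ l) : ∫ x, f x * g x ∂(unifSph ζ) = 0 := by
  wlog hlt : k < l generalizing k l f g
  · simp only [mul_comm (f _)]
    exact this hkl.symm hg hf (by omega)
  obtain ⟨p, ⟨hp, -⟩, rfl⟩ := hf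
  obtain ⟨q, ⟨hq, hΔ⟩, rfl⟩ := hg
  simpa [sphInt_apply] using
    (sphInt_eq_zero_iff hζ (hp.mul hq)).2 (gaussInt_mul_eq_zero hlt hp hq hΔ)

end SphericalHarmonics

section HarmonicSystem

lemma orthonormal_toLp_iff {X ι : Type*} [TopologicalSpace X] [CompactSpace X]
    [MeasurableSpace X] [BorelSpace X] [DecidableEq ι] {μ : Measure X} [IsFiniteMeasure μ]
    {v : ι → C(X, ℝ)} :
    Orthonormal ℝ (fun i => ContinuousMap.toLp (E := ℝ) 2 μ ℝ (v i)) ↔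
      ∀ i j, ∫ x, v i x * v j x ∂μ = if i = j then 1 else 0 := by
  simp only [orthonormal_iff_ite, ContinuousMap.inner_toLp, conj_trivial, mul_comm]

variable {ζ : ℕ} {Y : (k : ℕ) → Fin (numHarm ζ k) → C(Sph ζ, ℝ)}

lemma span_range_eq_sphHarm (hY : IsHarmonicSystem ζ Y) (k : ℕ) :
    Submodule.span ℝ (range (Y k)) = sphHarm ζ k := by
  have independent : LinearIndependent ℝ (Y k) :=
    .of_comp (ContinuousMap.toLp (E := ℝ) 2 (unifSph ζ) ℝ).toLinearMap
      (orthonormal_toLp_iff.2 (hY.2 k)).linearIndependent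
  refine Submodule.eq_of_le_of_finrank_eq (Submodule.span_le.2 ?_) ?_
  · rintro _ ⟨j, rfl⟩
    exact hY.1 k j
  · rw [finrank_span_eq_card independent, Fintype.card_fin, numHarm]

lemma integral_prod_unif {d : ℕ} (f : Fin d → Sph ζ → ℝ) :
    ∫ x, ∏ i, f i (x i) ∂(unif ζ d) = ∏ i, ∫ x, f i x ∂(unifSph ζ) :=
  integral_fintype_prod_eq_prod f

lemma prodFun_apply {d : ℕ} (f : Fin d → C(Sph ζ, ℝ)) (x : MS ζ d) :
    prodFun f x = ∏ i, f i (x i) := rfl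

theorem orthonormal_toLp_shProduct (hζ : 0 < ζ) (hY : IsHarmonicSystem ζ Y) (d : ℕ) :
    Orthonormal ℝ (fun p => ContinuousMap.toLp (E := ℝ) 2 (unif ζ d) ℝ
      (shProduct (d := d) Y p)) := by
  refine orthonormal_toLp_iff.2 ?_
  rintro ⟨k, j⟩ ⟨k', j'⟩
  simp only [shProduct, prodFun_apply, ← Finset.prod_mul_distrib]
  rw [integral_prod_unif fun i x => Y (k i) (j i) x * Y (k' i) (j' i) x]
  split_ifs with heq
  · cases heq
    exact Finset.prod_eq_one fun i _ => by rw [hY.2, if_pos rfl]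
  · suffices ∃ i, ∫ x, Y (k i) (j i) x * Y (k' i) (j' i) x ∂(unifSph ζ) = 0 from
      Finset.prod_eq_zero_iff.2 (this.imp fun i hi => ⟨Finset.mem_univ i, hi⟩)
    by_cases hk : k = k'
    · subst hk
      obtain ⟨i, hi⟩ := Function.ne_iff.1 fun hj : j = j' => heq (by rw [hj])
      exact ⟨i, by rw [hY.2, if_neg hi]⟩
    · obtain ⟨i, hi⟩ := Function.ne_iff.1 hk
      exact ⟨i, integral_mul_eq_zero_of_mem_sphHarm hζ hi (hY.1 _ _) (hY.1 _ _)⟩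

lemma toSubmodule_finsetSup {R A ι : Type*} [CommSemiring R] [CommSemiring A] [Algebra R A]
    (s : Finset ι) (B : ι → Subalgebra R A) :
    Subalgebra.toSubmodule (s.sup B) = ∏ i ∈ s, Subalgebra.toSubmodule (B i) := by
  classical
  induction s using Finset.induction_on with
  | empty => rw [Finset.sup_empty, Finset.prod_empty, Algebra.toSubmodule_bot]
  | insert i s hi ih =>
    rw [Finset.sup_insert, ← Subalgebra.mul_toSubmodule, ih, Finset.prod_insert hi]

/-- The algebra homomorphism taking a function on the sphere to a function of the `i`-th pixel. -/
def pixelPullback {d : ℕ} (ζ : ℕ) (i : Fin d) : C(Sph ζ, ℝ) →ₐ[ℝ] C(MS ζ d, ℝ) :=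
  ContinuousMap.compRightAlgHom ℝ ℝ ⟨fun x => x i, continuous_apply i⟩

lemma prod_pixelPullback {d : ℕ} (f : Fin d → C(Sph ζ, ℝ)) :
    ∏ i, pixelPullback ζ i (f i) = prodFun f := by
  ext x
  simp [pixelPullback, prodFun]

/-- The polynomials in the coordinates of all pixels, as functions on the multisphere. -/
def pixelPolynomials (ζ d : ℕ) : Subalgebra ℝ C(MS ζ d, ℝ) :=
  Finset.univ.sup fun i => (restrictSph ζ).range.map (pixelPullback ζ i)

lemma separatesPoints_pixelPolynomials (ζ d : ℕ) : (pixelPolynomials ζ d).SeparatesPoints := by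
  intro x y hxy
  obtain ⟨i, hi⟩ := Function.ne_iff.1 hxy
  obtain ⟨j, hj⟩ : ∃ j, (x i).1 j ≠ (y i).1 j := by
    by_contra! hcon
    exact hi (Subtype.ext (PiLp.ext hcon))
  have hle : (restrictSph ζ).range.map (pixelPullback ζ i) ≤ pixelPolynomials ζ d :=
    Finset.le_sup (f := fun i => (restrictSph ζ).range.map (pixelPullback ζ i)) (Finset.mem_univ i)
  refine ⟨_, ⟨_, hle ⟨_, ⟨MvPolynomial.X j, rfl⟩, rfl⟩, rfl⟩, ?_⟩
  simpa [pixelPullback, restrictSph_apply] using hj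

lemma pixelPolynomials_le_span_range_shProduct (hζ : 0 < ζ) (hY : IsHarmonicSystem ζ Y) (d : ℕ) :
    Subalgebra.toSubmodule (pixelPolynomials ζ d) ≤
      Submodule.span ℝ (range (shProduct (d := d) Y)) := by
  have range_le : Subalgebra.toSubmodule (restrictSph ζ).range ≤
      Submodule.span ℝ (⋃ k, range (Y k)) := by
    rintro _ ⟨p, rfl⟩
    simp only [Submodule.span_iUnion, span_range_eq_sphHarm hY]
    exact restrictSph_mem_iSup_sphHarm hζ p
  have map_le (i : Fin d) :
      Subalgebra.toSubmodule ((restrictSph ζ).range.map (pixelPullback ζ i)) ≤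
        Submodule.span ℝ (pixelPullback ζ i '' ⋃ k, range (Y k)) := by
    rw [Subalgebra.map_toSubmodule]
    exact (Submodule.map_mono range_le).trans (Submodule.map_span_le _ _ _ |>.2
      fun f hf => Submodule.subset_span ⟨f, hf, rfl⟩)
  rw [pixelPolynomials, toSubmodule_finsetSup]
  refine (Finset.prod_le_prod' fun i _ => map_le i).trans ?_
  rw [Submodule.prod_span]
  refine Submodule.span_mono fun F hF => ?_
  obtain ⟨g, hg, rfl⟩ := (Set.mem_fintype_prod _ _).1 hF
  have (i : Fin d) : ∃ k j, pixelPullback ζ i (Y k j) = g i := by simpa using hg i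
  choose k j hkj using this
  exact ⟨⟨k, j⟩, by simp only [shProduct, ← prod_pixelPullback, hkj]⟩

theorem topologicalClosure_span_toLp_shProduct (hζ : 0 < ζ) (hY : IsHarmonicSystem ζ Y) (d : ℕ) :
    (Submodule.span ℝ (range fun p => ContinuousMap.toLp (E := ℝ) 2 (unif ζ d) ℝ
      (shProduct (d := d) Y p))).topologicalClosure = ⊤ := by
  have dense_polynomials : Dense (pixelPolynomials ζ d : Set C(MS ζ d, ℝ)) := by
    rw [dense_iff_closure_eq, ← Subalgebra.topologicalClosure_coe,
      ContinuousMap.subalgebra_topologicalClosure_eq_top_of_separatesPoints _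
        (separatesPoints_pixelPolynomials ζ d), Algebra.coe_top]
  have dense_span :
      (Submodule.span ℝ (range (shProduct (d := d) Y))).topologicalClosure = ⊤ :=
    (Submodule.dense_iff_topologicalClosure_eq_top).1
      (dense_polynomials.mono (pixelPolynomials_le_span_range_shProduct hζ hY d))
  have := (ContinuousMap.toLp_denseRange ℝ (unif ζ d) ℝ
    (p := 2) (by norm_num)).topologicalClosure_map_submodule dense_span
  rwa [Submodule.map_span, ← range_comp] at this

end HarmonicSystem

section FunkHecke

variable {ζ : ℕ}

lemma integral_inner_pow_mul_restrictSph (x : Sph ζ) (m : ℕ) (p : MvPolynomial (Fin ζ) ℝ) :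
    ∫ z, inner ℝ x.1 z.1 ^ m * restrictSph ζ p z ∂(unifSph ζ) =
      sphInt ζ (linForm x.1.ofLp ^ m * p) := by
  simp [sphInt_apply, restrictSph_apply, linForm, PiLp.inner_apply, mul_comm]

lemma integral_inner_pow_mul (hζ : 2 ≤ ζ) {k : ℕ} {f : C(Sph ζ, ℝ)} (hf : f ∈ sphHarm ζ k)
    (x : Sph ζ) (j : ℕ) :
    ∫ z, inner ℝ x.1 z.1 ^ (k + 2 * j) * f z ∂(unifSph ζ) = powEigenvalue ζ k j * f x := by
  obtain ⟨p, ⟨hp, hΔ⟩, rfl⟩ := hf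
  rw [AlgHom.toLinearMap_apply, integral_inner_pow_mul_restrictSph,
    sphInt_linForm_pow_mul (sum_sq_eq_one x) hζ k j hp hΔ, restrictSph_apply]

lemma integral_inner_pow_mul_eq_zero (hζ : 2 ≤ ζ) {k m : ℕ} (hm : ∀ j, m ≠ k + 2 * j)
    {f : C(Sph ζ, ℝ)} (hf : f ∈ sphHarm ζ k) (x : Sph ζ) :
    ∫ z, inner ℝ x.1 z.1 ^ m * f z ∂(unifSph ζ) = 0 := by
  obtain ⟨p, ⟨hp, hΔ⟩, rfl⟩ := hf
  rw [AlgHom.toLinearMap_apply, integral_inner_pow_mul_restrictSph,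
    sphInt_linForm_pow_mul_eq_zero (sum_sq_eq_one x) hζ hm hp hΔ]

lemma abs_inner_le_one (x z : Sph ζ) : |inner ℝ x.1 z.1| ≤ 1 := by
  simpa using abs_real_inner_le_norm x.1 z.1

lemma hasSum_integral_inner_pow_mul {ρ : ℕ → ℝ} (hρ : Summable ρ) (f : C(Sph ζ, ℝ)) (x : Sph ζ) :
    HasSum (fun m => ρ m * ∫ z, inner ℝ x.1 z.1 ^ m * f z ∂(unifSph ζ))
      (∫ z, (∑' m, ρ m * inner ℝ x.1 z.1 ^ m) * f z ∂(unifSph ζ)) := by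
  have norm_term_le (m : ℕ) (z : Sph ζ) : ‖ρ m * inner ℝ x.1 z.1 ^ m‖ ≤ ‖ρ m‖ := by
    rw [norm_mul, norm_pow]
    exact mul_le_of_le_one_right (norm_nonneg _)
      (pow_le_one₀ (norm_nonneg _) (abs_inner_le_one x z))
  have := hasSum_integral_of_dominated_convergence (μ := unifSph ζ)
    (F := fun m z => ρ m * inner ℝ x.1 z.1 ^ m * f z) (fun m _ => ‖ρ m‖ * ‖f‖)
    (fun m => Continuous.aestronglyMeasurable (by fun_prop))
    (fun m => ae_of_all _ fun z => (norm_mul_le _ _).trans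
      (mul_le_mul (norm_term_le m z) (f.norm_coe_le_norm z) (norm_nonneg _) (norm_nonneg _)))
    (ae_of_all _ fun _ => hρ.norm.mul_right _) (integrable_const _)
    (ae_of_all _ fun z => (Summable.of_norm_bounded hρ.norm (norm_term_le · z)).hasSum.mul_right _)
  simpa only [mul_assoc, integral_const_mul] using this

theorem integral_tsum_inner_pow_mul (hζ : 2 ≤ ζ) {ρ : ℕ → ℝ} (hρ : Summable ρ) {k : ℕ}
    {f : C(Sph ζ, ℝ)} (hf : f ∈ sphHarm ζ k) (x : Sph ζ) :
    ∫ z, (∑' m, ρ m * inner ℝ x.1 z.1 ^ m) * f z ∂(unifSph ζ) = dotEigenvalue ζ ρ k * f x := by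
  have injective : Function.Injective fun j : ℕ => k + 2 * j := fun i j h => by simpa using h
  have hsum := hasSum_integral_inner_pow_mul hρ f x
  rw [← injective.hasSum_iff fun m hm => by
    rw [integral_inner_pow_mul_eq_zero hζ (fun j hj => hm ⟨j, hj.symm⟩) hf, mul_zero]] at hsum
  simp only [Function.comp_def, integral_inner_pow_mul hζ hf, ← mul_assoc] at hsum
  exact hsum.unique ((summable_mul_powEigenvalue hζ hρ k).hasSum.mul_right (f x))

end FunkHecke

section PowerSeries

lemma summable_mul_of_abs_le_one {α : Type*} {e w : α → ℝ} (he : Summable e)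
    (hw : ∀ n, |w n| ≤ 1) : Summable fun n => e n * w n :=
  .of_norm_bounded he.norm fun n =>
    (norm_mul _ _).trans_le (mul_le_of_le_one_right (norm_nonneg _) (hw n))

lemma abs_prod_pow_le_one {ι : Type*} [Fintype ι] {t : ι → ℝ} (ht : ∀ i, |t i| ≤ 1) (n : ι → ℕ) :
    |∏ i, t i ^ n i| ≤ 1 := by
  simp only [Finset.abs_prod, abs_pow]
  exact Finset.prod_le_one (fun _ _ => by positivity)
    fun i _ => pow_le_one₀ (abs_nonneg _) (ht i)

lemma hasSum_mul_prodMk {α β : Type*} {f : α → ℝ} {g : β → ℝ} {r s : ℝ} (hf : HasSum f r)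
    (hg : HasSum g s) : HasSum (fun p : α × β => f p.1 * g p.2) (r * s) :=
  hf.mul hg (summable_mul_of_summable_norm hf.summable.norm hg.summable.norm)

lemma eq_zero_of_tsum_mul_pow_eq_zero {a : ℕ → ℝ} (ha : Summable a)
    (h : ∀ t, |t| ≤ 1 → ∑' m, a m * t ^ m = 0) : a = 0 := by
  have hradius : 0 < (FormalMultilinearSeries.ofScalars ℝ a).radius :=
    zero_lt_one.trans_le (FormalMultilinearSeries.le_radius_of_summable_norm (r := 1) _
      (by simpa [FormalMultilinearSeries.ofScalars_norm] using ha.abs))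
  have hseries := (FormalMultilinearSeries.hasFPowerSeriesOnBall _ hradius).hasFPowerSeriesAt
  refine (FormalMultilinearSeries.ofScalars_series_eq_zero ℝ).1
    (hseries.eq_zero_of_eventually ?_)
  filter_upwards [Metric.closedBall_mem_nhds (0 : ℝ) one_pos] with t ht
  exact (FormalMultilinearSeries.ofScalars_sum_eq a t).trans (h t (by simpa using ht))

variable {d : ℕ}

lemma tsum_mul_prod_cons_pow {e : (Fin (d + 1) → ℕ) → ℝ} (he : Summable e) {t : ℝ} (ht : |t| ≤ 1)
    {u : Fin d → ℝ} (hu : ∀ i, |u i| ≤ 1) :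
    ∑' n, e n * ∏ i, (Fin.cons t u : Fin (d + 1) → ℝ) i ^ n i =
      ∑' m, (∑' n : Fin d → ℕ, e (Fin.cons m n) * ∏ i, u i ^ n i) * t ^ m := by
  let φ := Fin.consEquiv fun _ : Fin (d + 1) => ℕ
  have hsummable := φ.summable_iff.2 (summable_mul_of_abs_le_one he (abs_prod_pow_le_one
    (t := Fin.cons t u) (Fin.cases ht hu)))
  rw [← φ.tsum_eq (fun n => e n * ∏ i, (Fin.cons t u : Fin (d + 1) → ℝ) i ^ n i)]
  refine hsummable.tsum_prod.trans ?_
  simp only [Function.comp_apply, φ, Fin.consEquiv_apply, Fin.prod_univ_succ, Fin.cons_zero,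
    Fin.cons_succ, ← tsum_mul_right, mul_assoc, mul_comm (t ^ _)]
  rfl

theorem eq_zero_of_tsum_mul_prod_pow_eq_zero {e : (Fin d → ℕ) → ℝ} (he : Summable e)
    (h : ∀ t : Fin d → ℝ, (∀ i, |t i| ≤ 1) → ∑' n, e n * ∏ i, t i ^ n i = 0) : e = 0 := by
  induction d with
  | zero => simpa [funext_iff, Unique.forall_iff, tsum_fintype] using h
  | succ d ih =>
    let φ := Fin.consEquiv fun _ : Fin (d + 1) => ℕ
    have slice_eq_zero (m : ℕ) : (fun n : Fin d → ℕ => e (Fin.cons m n)) = 0 := by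
      refine ih ((φ.summable_iff.2 he).prod_factor m) fun u hu => ?_
      have hsummable : Summable fun p : ℕ × (Fin d → ℕ) =>
          e (Fin.cons p.1 p.2) * ∏ i, u i ^ p.2 i :=
        summable_mul_of_abs_le_one (φ.summable_iff.2 he) fun p => abs_prod_pow_le_one hu p.2
      refine congrFun (eq_zero_of_tsum_mul_pow_eq_zero hsummable.prod fun t ht => ?_) m
      rw [← tsum_mul_prod_cons_pow he ht hu]
      exact h _ (Fin.cases ht hu)
    funext n
    rw [← Fin.cons_self_tail n]
    exact congrFun (slice_eq_zero (n 0)) (Fin.tail n)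

lemma hasSum_prod_apply {f : Fin d → ℕ → ℝ} {s : Fin d → ℝ} (h : ∀ i, HasSum (f i) (s i)) :
    HasSum (fun n : Fin d → ℕ => ∏ i, f i (n i)) (∏ i, s i) := by
  induction d with
  | zero => simp
  | succ d ih =>
    have htail := ih fun i => h i.succ
    have hmul := hasSum_mul_prodMk (h 0) htail
    rw [← (Fin.consEquiv fun _ : Fin (d + 1) => ℕ).hasSum_iff, Fin.prod_univ_succ]
    simpa only [Function.comp_def, Fin.consEquiv_apply, Fin.prod_univ_succ, Fin.cons_zero,
      Fin.cons_succ] using hmul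

end PowerSeries

section ProductCoefficients

variable {d : ℕ}

/-- The `i`-th marginal `m ↦ ∑_{n : n_i = m} b n` of a family indexed by multi-indices. Up to a
constant, it is the coefficient sequence of the `i`-th factor of a factorizable power series. -/
def marginal (b : (Fin d → ℕ) → ℝ) (i : Fin d) (m : ℕ) : ℝ :=
  ∑' n : {n : Fin d → ℕ // n i = m}, b n

lemma marginal_nonneg {b : (Fin d → ℕ) → ℝ} (hb : ∀ n, 0 ≤ b n) (i : Fin d) (m : ℕ) :
    0 ≤ marginal b i m :=
  tsum_nonneg fun n => hb n

lemma hasSum_marginal_mul_pow {b : (Fin d → ℕ) → ℝ} (hb : Summable b) (i : Fin d) {t s : ℝ}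
    (h : HasSum (fun n => b n * t ^ n i) s) : HasSum (fun m => marginal b i m * t ^ m) s := by
  rw [← (Equiv.sigmaFiberEquiv fun n : Fin d → ℕ => n i).hasSum_iff] at h
  refine h.sigma fun m => ?_
  convert! (hb.subtype {n | n i = m}).hasSum.mul_right (t ^ m) using 1
  funext n
  simp [Equiv.sigmaFiberEquiv, show n.1 i = m from n.2]

/-- The family `b` is, up to the constant `A`, the product of the probability distributions `ρ i`
on `ℕ`. This is the factorization of the coefficients of a factorizable kernel. -/
structure IsProductCoeff (b : (Fin d → ℕ) → ℝ) (A : ℝ) (ρ : Fin d → ℕ → ℝ) : Prop where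
  pos : 0 < A
  nonneg : ∀ i m, 0 ≤ ρ i m
  hasSum_one : ∀ i, HasSum (ρ i) 1
  eq_mul_prod : ∀ n, b n = A * ∏ i, ρ i (n i)

lemma hasSum_marginal_mul_pow_of_prod {κ : Fin d → ℝ → ℝ} {b : (Fin d → ℕ) → ℝ}
    (hκ : ∀ i, κ i 1 ≠ 0)
    (hsum : ∀ t : Fin d → ℝ, (∀ i, |t i| ≤ 1) →
      HasSum (fun n => b n * ∏ i, t i ^ n i) (∏ i, κ i (t i))) (i : Fin d) {t : ℝ} (ht : |t| ≤ 1) :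
    HasSum (fun m => marginal b i m * t ^ m) ((∏ j, κ j 1) * (κ i t / κ i 1)) := by
  have hb : Summable b := by simpa using (hsum 1 (by simp)).summable
  have prod_update_pow (n : Fin d → ℕ) : ∏ j, Function.update (1 : Fin d → ℝ) i t j ^ n j =
      t ^ n i := by
    rw [Fintype.prod_eq_single i fun j hj => by simp [hj], Function.update_self]
  have prod_update : ∏ j, κ j (Function.update (1 : Fin d → ℝ) i t j) =
      (∏ j, κ j 1) * (κ i t / κ i 1) := by
    rw [← Finset.mul_prod_erase _ _ (Finset.mem_univ i),
      ← Finset.mul_prod_erase _ (fun j => κ j 1) (Finset.mem_univ i), Function.update_self,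
      Finset.prod_congr rfl fun j hj => by rw [Function.update_of_ne (Finset.ne_of_mem_erase hj)]]
    field_simp [hκ i]
    rfl
  have hupdate := hsum (Function.update 1 i t) fun j => by
    by_cases hj : j = i <;> simp [hj, ht]
  simp only [prod_update_pow, prod_update] at hupdate
  exact hasSum_marginal_mul_pow hb i hupdate

theorem exists_isProductCoeff {κ : Fin d → ℝ → ℝ} {b : (Fin d → ℕ) → ℝ} (hb : ∀ n, 0 ≤ b n)
    (hne : b ≠ 0)
    (hsum : ∀ t : Fin d → ℝ, (∀ i, |t i| ≤ 1) →
      HasSum (fun n => b n * ∏ i, t i ^ n i) (∏ i, κ i (t i))) :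
    ∃ A ρ, IsProductCoeff b A ρ := by
  have hb_hasSum : HasSum b (∏ i, κ i 1) := by simpa using hsum 1 (by simp)
  set A := ∏ i, κ i 1 with hA_def
  have hA : 0 < A := by
    obtain ⟨n, hn⟩ := Function.ne_iff.1 hne
    rw [← hb_hasSum.tsum_eq]
    exact hb_hasSum.summable.tsum_pos hb n ((hb n).lt_of_ne' hn)
  have hκ (i : Fin d) : κ i 1 ≠ 0 := Finset.prod_ne_zero_iff.1 hA.ne' i (Finset.mem_univ i)
  let ρ : Fin d → ℕ → ℝ := fun i m => A⁻¹ * marginal b i m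
  have hρ (i : Fin d) {t : ℝ} (ht : |t| ≤ 1) :
      HasSum (fun m => ρ i m * t ^ m) (κ i t / κ i 1) := by
    have := (hasSum_marginal_mul_pow_of_prod hκ hsum i ht).mul_left A⁻¹
    rw [inv_mul_cancel_left₀ hA.ne'] at this
    simpa only [ρ, mul_assoc] using this
  have hρ_one (i : Fin d) : HasSum (ρ i) 1 := by simpa [hκ i] using hρ i (t := 1) (by simp)
  refine ⟨A, ρ, hA, fun i m => mul_nonneg (inv_nonneg.2 hA.le) (marginal_nonneg hb i m), hρ_one,
    fun n => sub_eq_zero.1 (congrFun (eq_zero_of_tsum_mul_prod_pow_eq_zero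
      (e := fun n => b n - A * ∏ i, ρ i (n i)) ?_ fun t ht => ?_) n)⟩
  · exact hb_hasSum.summable.sub ((hasSum_prod_apply hρ_one).summable.mul_left A)
  · have hdiff := (hsum t ht).sub ((hasSum_prod_apply fun i => hρ i (ht i)).mul_left A)
    rw [Finset.prod_div_distrib, ← hA_def, mul_div_cancel₀ _ hA.ne', sub_self] at hdiff
    simpa only [sub_mul, mul_assoc, ← Finset.prod_mul_distrib] using hdiff.tsum_eq

namespace IsProductCoeff

variable {b : (Fin d → ℕ) → ℝ} {A : ℝ} {ρ : Fin d → ℕ → ℝ}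

lemma apply_eq_zero (h : IsProductCoeff b A ρ) {i : Fin d} (hi : i ∉ receptiveField b) {m : ℕ}
    (hm : 0 < m) : ρ i m = 0 := by
  have exists_ne_zero (j : Fin d) : ∃ n, ρ j n ≠ 0 := by
    by_contra! hj
    simpa [hj] using (h.hasSum_one j).tsum_eq
  choose n hn using exists_ne_zero
  have hb : b (Function.update n i m) = 0 := by
    by_contra hb
    exact hi (by simpa [receptiveField] using ⟨_, by simpa using Nat.succ_le_of_lt hm, hb⟩)
  rw [h.eq_mul_prod, mul_eq_zero_iff_left h.pos.ne', Finset.prod_eq_zero_iff] at hb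
  obtain ⟨j, -, hj⟩ := hb
  by_cases hji : j = i
  · subst hji; simpa using hj
  · exact absurd hj (by simpa [hji] using hn j)

lemma apply_zero_eq_one (h : IsProductCoeff b A ρ) {i : Fin d} (hi : i ∉ receptiveField b) :
    ρ i 0 = 1 :=
  (hasSum_single 0 fun _ hm => h.apply_eq_zero hi (Nat.pos_of_ne_zero hm)).unique (h.hasSum_one i)

lemma hasSum_mul_prod_pow (h : IsProductCoeff b A ρ) {t : Fin d → ℝ} (ht : ∀ i, |t i| ≤ 1) :
    HasSum (fun n => b n * ∏ i, t i ^ n i) (A * ∏ i, ∑' m, ρ i m * t i ^ m) := by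
  have factor_hasSum (i : Fin d) : HasSum (fun m => ρ i m * t i ^ m) (∑' m, ρ i m * t i ^ m) :=
    (summable_mul_of_abs_le_one (h.hasSum_one i).summable fun m => by
      rw [abs_pow]; exact pow_le_one₀ (abs_nonneg _) (ht i)).hasSum
  simpa only [h.eq_mul_prod, mul_assoc, ← Finset.prod_mul_distrib] using
    (hasSum_prod_apply factor_hasSum).mul_left A

end IsProductCoeff

end ProductCoefficients

section PowerDecay

/-- The ratios `f a / f a'` tend to `1`, so `log ∘ f` is Cauchy. -/
lemma exists_tendsto_of_tendsto_mul {α : Type*} [Nonempty α] [SemilatticeSup α] {f g : α → ℝ}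
    (hf : ∀ a, 0 ≤ f a) {L : ℝ} (hL : 0 < L)
    (h : Tendsto (fun p : α × α => f p.1 * g p.2) (atTop ×ˢ atTop) (𝓝 L)) :
    ∃ l, 0 < l ∧ Tendsto f atTop (𝓝 l) := by
  have hlog := (continuousAt_log hL.ne').tendsto.comp h
  have hpos : ∀ᶠ p : α × α in atTop ×ˢ atTop, 0 < f p.1 * g p.2 := h.eventually_const_lt hL
  have diagonal : Tendsto (fun p : α × α => (p.2, p.2)) (atTop ×ˢ atTop) (atTop ×ˢ atTop) :=
    tendsto_snd.prodMk tendsto_snd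
  have log_sub_log : Tendsto (fun p : α × α => log (f p.1) - log (f p.2)) (atTop ×ˢ atTop)
      (𝓝 0) := by
    rw [← sub_self (log L)]
    refine (hlog.sub (hlog.comp diagonal)).congr' ?_
    filter_upwards [hpos, diagonal.eventually hpos] with p hp hp'
    simp only [Function.comp_apply]
    rw [log_mul (left_ne_zero_of_mul hp.ne') (right_ne_zero_of_mul hp.ne'),
      log_mul (left_ne_zero_of_mul hp'.ne') (right_ne_zero_of_mul hp'.ne'),
      add_sub_add_right_eq_sub]
  have hcauchy : CauchySeq fun a => log (f a) := by
    rw [cauchySeq_iff_tendsto_dist_atTop_0, ← prod_atTop_atTop_eq]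
    simpa only [Real.dist_eq, abs_zero] using log_sub_log.abs
  obtain ⟨l, hl⟩ := cauchySeq_tendsto_of_complete hcauchy
  refine ⟨exp l, exp_pos l, ((continuous_exp.tendsto l).comp hl).congr' ?_⟩
  filter_upwards [(tendsto_id.prodMk tendsto_id).eventually hpos] with a ha
  exact exp_log ((hf a).lt_of_ne' (left_ne_zero_of_mul ha.ne'))

variable {d : ℕ} {R S : Finset (Fin d)}

lemma tendsto_atTopOn_iff {α : Type*} {l : Filter α} {φ : α → Fin d → ℕ} :
    Tendsto φ l (atTopOn S) ↔
      (∀ i ∈ S, Tendsto (φ · i) l atTop) ∧ ∀ᶠ a in l, ∀ i ∉ S, φ a i = 0 := by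
  simp only [atTopOn, tendsto_inf, tendsto_iInf, tendsto_comap_iff, tendsto_principal,
    Function.comp_def, mem_ofPred_eq]

lemma tendsto_apply_atTopOn {i : Fin d} (hi : i ∈ S) :
    Tendsto (fun n : Fin d → ℕ => n i) (atTopOn S) atTop :=
  (tendsto_atTopOn_iff.1 tendsto_id).1 i hi

lemma eventually_atTopOn_eq_zero : ∀ᶠ n in atTopOn S, ∀ i ∉ S, n i = 0 :=
  (tendsto_atTopOn_iff.1 tendsto_id).2

instance atTopOn_neBot : (atTopOn S).NeBot :=
  (tendsto_atTopOn_iff (l := atTop) (φ := fun (N : ℕ) i => if i ∈ S then N else 0).2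
    ⟨fun i hi => by simpa only [hi, if_true] using! tendsto_id,
      .of_forall fun N i hi => if_neg hi⟩).neBot

/-- The factor `k ^ (-a)` of `powProd`, which is `1` at `k = 0`. -/
def powFactor (a : ℝ) (k : ℕ) : ℝ := if 0 < k then (k : ℝ) ^ (-a) else 1

lemma powFactor_zero (a : ℝ) : powFactor a 0 = 1 := if_neg (lt_irrefl 0)

lemma powFactor_pos (a : ℝ) (k : ℕ) : 0 < powFactor a k := by
  unfold powFactor
  split_ifs <;> positivity

lemma powFactor_eventuallyEq (a : ℝ) : powFactor a =ᶠ[atTop] fun k : ℕ => (k : ℝ) ^ (-a) := by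
  filter_upwards [eventually_gt_atTop 0] with k hk using if_pos hk

lemma powProd_eq_prod_powFactor (R : Finset (Fin d)) (a : ℝ) (n : Fin d → ℕ) :
    powProd R a n = ∏ i ∈ R, powFactor a (n i) :=
  Finset.prod_filter _ _

lemma powProd_pos (R : Finset (Fin d)) (a : ℝ) (n : Fin d → ℕ) : 0 < powProd R a n := by
  rw [powProd_eq_prod_powFactor]
  exact Finset.prod_pos fun i _ => powFactor_pos a (n i)

lemma powProd_eq_of_subset (hSR : S ⊆ R) (a : ℝ) {n : Fin d → ℕ} (hn : ∀ i ∉ S, n i = 0) :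
    powProd R a n = powProd S a n := by
  simp only [powProd_eq_prod_powFactor]
  exact (Finset.prod_subset hSR fun i _ hi => by rw [hn i hi, powFactor_zero]).symm

lemma exists_tendsto_of_tendsto_prod {f : Fin d → ℕ → ℝ} (hf : ∀ i m, 0 ≤ f i m) {L : ℝ}
    (hL : 0 < L) (h : Tendsto (fun n : Fin d → ℕ => ∏ j ∈ R, f j (n j)) (atTopOn R) (𝓝 L))
    {i : Fin d} (hi : i ∈ R) : ∃ l, 0 < l ∧ Tendsto (f i) atTop (𝓝 l) := by
  let φ : ℕ × ℕ → Fin d → ℕ := fun p j => if j = i then p.1 else if j ∈ R then p.2 else 0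
  have hφ : Tendsto φ (atTop ×ˢ atTop) (atTopOn R) := by
    refine tendsto_atTopOn_iff.2 ⟨fun j hj => ?_, .of_forall fun p j hj => ?_⟩
    · by_cases hji : j = i
      · simpa [φ, hji] using tendsto_fst
      · simpa [φ, hji, hj] using tendsto_snd
    · simp [φ, ne_of_mem_of_not_mem hi hj |>.symm, hj]
  refine exists_tendsto_of_tendsto_mul (g := fun m => ∏ j ∈ R.erase i, f j m) (hf i) hL
    ((h.comp hφ).congr fun p => ?_)
  rw [Function.comp_apply, ← Finset.mul_prod_erase _ _ hi]
  congr 1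
  · simp [φ]
  · refine Finset.prod_congr rfl fun j hj => ?_
    rw [Finset.mem_erase] at hj
    simp [φ, hj.1, hj.2]

theorem IsProductCoeff.exists_isEquivalent {b : (Fin d → ℕ) → ℝ} {c ν A : ℝ} (hc : 0 < c)
    {ρ : Fin d → ℕ → ℝ} (h : IsProductCoeff b A ρ)
    (hasymp : b ~[atTopOn (receptiveField b)] fun n => c * powProd (receptiveField b) ν n)
    {i : Fin d} (hi : i ∈ receptiveField b) :
    ∃ l, 0 < l ∧ ρ i ~[atTop] fun m : ℕ => l * (m : ℝ) ^ (-ν) := by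
  set R := receptiveField b
  have hratio := (Asymptotics.isEquivalent_iff_tendsto_one
    (.of_forall fun n => (mul_pos hc (powProd_pos R ν n)).ne')).1 hasymp
  have hprod : Tendsto (fun n : Fin d → ℕ => ∏ j ∈ R, ρ j (n j) / powFactor ν (n j)) (atTopOn R)
      (𝓝 (c / A)) := by
    rw [← mul_one (c / A)]
    refine (hratio.const_mul (c / A)).congr' ?_
    filter_upwards [eventually_atTopOn_eq_zero] with n hn
    have hb : b n = A * ∏ j ∈ R, ρ j (n j) := by
      rw [h.eq_mul_prod, Finset.prod_subset (Finset.subset_univ R) fun j _ hj => by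
        rw [hn j hj, h.apply_zero_eq_one hj]]
    have := h.pos
    have := powProd_pos R ν n
    rw [Pi.div_apply, hb, Finset.prod_div_distrib, ← powProd_eq_prod_powFactor]
    field_simp
  obtain ⟨l, hl, hlim⟩ := exists_tendsto_of_tendsto_prod
    (fun j m => div_nonneg (h.nonneg j m) (powFactor_pos ν m).le) (div_pos hc h.pos) hprod hi
  refine ⟨l, hl, ((((Asymptotics.isEquivalent_const_iff_tendsto hl.ne').2 hlim).mul
    (.refl (u := powFactor ν))).congr_left (.of_forall fun m => ?_)).congr_right ?_⟩
  · exact div_mul_cancel₀ _ (powFactor_pos ν m).ne'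
  · exact (powFactor_eventuallyEq ν).mono fun m hm => congrArg (l * ·) hm

end PowerDecay

section EigenvalueProducts

variable {d : ℕ} {R S : Finset (Fin d)} {a : ℝ} {E : Fin d → ℕ → ℝ}

lemma exists_isEquivalent_prod (hSR : S ⊆ R) (hpos : ∀ i ∉ S, 0 < E i 0)
    (hE : ∀ i ∈ S, ∃ c, 0 < c ∧ E i ~[atTop] fun k : ℕ => c * (k : ℝ) ^ (-a)) :
    ∃ c, 0 < c ∧ (fun k : Fin d → ℕ => ∏ i, E i (k i)) ~[atTopOn S] fun k => c * powProd R a k := by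
  choose! c hc hEc using hE
  have hequiv : (fun k : Fin d → ℕ => ∏ i ∈ S, E i (k i)) ~[atTopOn S]
      fun k => (∏ i ∈ S, c i) * powProd S a k := by
    simp only [powProd_eq_prod_powFactor, ← Finset.prod_mul_distrib]
    refine .finsetProd fun i hi => ?_
    have hEc_factor : E i ~[atTop] fun k => c i * powFactor a k :=
      (hEc i hi).congr_right ((powFactor_eventuallyEq a).mono fun k hk => congrArg _ hk.symm)
    exact hEc_factor.comp_tendsto (tendsto_apply_atTopOn hi)
  have hcompl : 0 < ∏ i ∈ Sᶜ, E i 0 := Finset.prod_pos fun i hi => hpos i (Finset.mem_compl.1 hi)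
  refine ⟨(∏ i ∈ Sᶜ, E i 0) * ∏ i ∈ S, c i, mul_pos hcompl (Finset.prod_pos hc),
    (((Asymptotics.IsEquivalent.refl (u := fun _ => ∏ i ∈ Sᶜ, E i 0)).mul hequiv).congr_left
      ?_).congr_right ?_⟩
  · filter_upwards [eventually_atTopOn_eq_zero] with k hk
    rw [Pi.mul_apply, ← Finset.prod_compl_mul_prod S]
    congr 1
    exact Finset.prod_congr rfl fun i hi => by rw [hk i (Finset.mem_compl.1 hi)]
  · filter_upwards [eventually_atTopOn_eq_zero] with k hk
    rw [Pi.mul_apply, powProd_eq_of_subset hSR a hk, mul_assoc]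

lemma exists_mul_le_and_le_mul_of_isTheta {u v : ℕ → ℝ} (hu : ∀ k, 0 < u k) (hv : ∀ k, 0 < v k)
    (h : u =Θ[atTop] v) :
    ∃ c₁ c₂ : ℝ, 0 < c₁ ∧ 0 < c₂ ∧ ∀ k, c₁ * v k ≤ u k ∧ u k ≤ c₂ * v k := by
  obtain ⟨C₁, hC₁, h₁⟩ := Asymptotics.bound_of_isBigO_nat_atTop h.2
  obtain ⟨C₂, hC₂, h₂⟩ := Asymptotics.bound_of_isBigO_nat_atTop h.1
  simp only [Real.norm_eq_abs, abs_of_pos, hu, hv] at h₁ h₂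
  exact ⟨C₁⁻¹, C₂, inv_pos.2 hC₁, hC₂, fun k =>
    ⟨(inv_mul_le_iff₀ hC₁).2 (h₁ (hu k).ne'), h₂ (hv k).ne'⟩⟩

lemma exists_bounds_prod (hone : ∀ i ∉ R, E i 0 = 1) (hpos : ∀ i ∈ R, ∀ k, 0 < E i k)
    (hE : ∀ i ∈ R, ∃ c, 0 < c ∧ E i ~[atTop] fun k : ℕ => c * (k : ℝ) ^ (-a)) :
    ∃ c₁ c₂ : ℝ, 0 < c₁ ∧ 0 < c₂ ∧ ∀ k : Fin d → ℕ, (∀ i ∉ R, k i = 0) →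
      c₁ * powProd R a k ≤ ∏ i, E i (k i) ∧ ∏ i, E i (k i) ≤ c₂ * powProd R a k := by
  have hfactor (i : Fin d) (hi : i ∈ R) : ∃ c₁ c₂ : ℝ, 0 < c₁ ∧ 0 < c₂ ∧
      ∀ k, c₁ * powFactor a k ≤ E i k ∧ E i k ≤ c₂ * powFactor a k := by
    obtain ⟨c, hc, h⟩ := hE i hi
    refine exists_mul_le_and_le_mul_of_isTheta (hpos i hi) (powFactor_pos a) ?_
    exact (h.isTheta.of_const_mul_right hc.ne').trans_eventuallyEq
      (powFactor_eventuallyEq a).symm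
  choose! c₁ c₂ hc₁ hc₂ hbounds using hfactor
  refine ⟨∏ i ∈ R, c₁ i, ∏ i ∈ R, c₂ i, Finset.prod_pos hc₁, Finset.prod_pos hc₂, fun k hk => ?_⟩
  rw [← Finset.prod_subset (Finset.subset_univ R) fun i _ hi => by rw [hk i hi, hone i hi],
    powProd_eq_prod_powFactor, ← Finset.prod_mul_distrib, ← Finset.prod_mul_distrib]
  exact ⟨Finset.prod_le_prod (fun i hi => (mul_pos (hc₁ i hi) (powFactor_pos a _)).le)
      fun i hi => (hbounds i hi (k i)).1,
    Finset.prod_le_prod (fun i hi => (hpos i hi _).le) fun i hi => (hbounds i hi (k i)).2⟩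

end EigenvalueProducts

section FactorizableKernel

variable {ζ d : ℕ}

lemma exists_inner_eq (hζ : 2 ≤ ζ) (x : Sph ζ) {t : ℝ} (ht : |t| ≤ 1) :
    ∃ z : Sph ζ, inner ℝ x.1 z.1 = t := by
  have hrank : 1 < Module.rank ℝ (EuclideanSpace ℝ (Fin ζ)) := by
    rw [← Module.finrank_eq_rank, finrank_euclideanSpace_fin]
    exact_mod_cast hζ
  obtain ⟨z, hz, rfl⟩ := (isPreconnected_sphere hrank 0 1).intermediate_value (-x).2 x.2
    (f := inner ℝ x.1) (by fun_prop) (by simpa [abs_le] using ht)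
  exact ⟨⟨z, hz⟩, rfl⟩

lemma exists_dots_eq (hζ : 2 ≤ ζ) {t : Fin d → ℝ} (ht : ∀ i, |t i| ≤ 1) :
    ∃ x z : MS ζ d, dots x z = t := by
  let e : Sph ζ := ⟨EuclideanSpace.single ⟨0, by omega⟩ 1, by simp⟩
  choose z hz using fun i => exists_inner_eq hζ e (ht i)
  exact ⟨fun _ => e, z, funext hz⟩

variable {K : MS ζ d → MS ζ d → ℝ} {b : (Fin d → ℕ) → ℝ} {A : ℝ} {ρ : Fin d → ℕ → ℝ}

lemma IsFactorizable.exists_isProductCoeff (hK : IsFactorizable K) (hζ : 2 ≤ ζ)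
    (hb : ∀ n, 0 ≤ b n) (hne : b ≠ 0) (hKb : HasPowerSeries K b) :
    ∃ A ρ, IsProductCoeff b A ρ := by
  obtain ⟨κ, hκ⟩ := hK
  refine Multisphere.exists_isProductCoeff (κ := κ) hb hne fun t ht => ?_
  obtain ⟨x, z, rfl⟩ := exists_dots_eq hζ ht
  exact hκ x z ▸ hKb x z

lemma ne_zero_of_isEquivalent {R : Finset (Fin d)} {c ν : ℝ} (hc : 0 < c)
    (hasymp : b ~[atTopOn R] fun n => c * powProd R ν n) : b ≠ 0 := by
  rintro rfl
  obtain ⟨n, hn⟩ := (Asymptotics.isEquivalent_zero_iff_eventually_zero.1 hasymp.symm).exists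
  exact (mul_pos hc (powProd_pos R ν n)).ne' hn

lemma one_lt_of_isEquivalent {ρ : ℕ → ℝ} {l ν : ℝ} (hl : 0 < l) (hρ : Summable ρ)
    (h : ρ ~[atTop] fun m : ℕ => l * (m : ℝ) ^ (-ν)) : 1 < ν := by
  have := summable_of_isBigO_nat hρ h.isBigO_symm
  rw [summable_mul_left_iff hl.ne', Real.summable_nat_rpow] at this
  linarith

/-- The eigenvalue `λ_k` of a kernel whose power series has the product coefficients
`A * ∏ i, ρ i (n i)`. -/
def productEigenvalue (ζ : ℕ) (A : ℝ) (ρ : Fin d → ℕ → ℝ) (k : Fin d → ℕ) : ℝ :=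
  A * ∏ i, dotEigenvalue ζ (ρ i) (k i)

namespace IsProductCoeff

theorem integral_mul_prodFun (h : IsProductCoeff b A ρ) (hζ : 2 ≤ ζ) (hKb : HasPowerSeries K b)
    {k : Fin d → ℕ} {f : Fin d → C(Sph ζ, ℝ)} (hf : ∀ i, f i ∈ sphHarm ζ (k i)) (x : MS ζ d) :
    ∫ z, K x z * prodFun f z ∂(unif ζ d) = productEigenvalue ζ A ρ k * prodFun f x := by
  have kernel_eq (z : MS ζ d) : K x z = A * ∏ i, ∑' m, ρ i m * inner ℝ (x i).1 (z i).1 ^ m :=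
    (hKb x z).unique (h.hasSum_mul_prod_pow fun i => abs_inner_le_one (x i) (z i))
  calc ∫ z, K x z * prodFun f z ∂(unif ζ d)
      = A * ∫ z, ∏ i, (∑' m, ρ i m * inner ℝ (x i).1 (z i).1 ^ m) * f i (z i) ∂(unif ζ d) := by
        simp only [kernel_eq, prodFun_apply, mul_assoc, ← Finset.prod_mul_distrib,
          integral_const_mul]
    _ = A * ∏ i, dotEigenvalue ζ (ρ i) (k i) * f i (x i) := by
        rw [integral_prod_unif fun i z => (∑' m, ρ i m * inner ℝ (x i).1 z.1 ^ m) * f i z]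
        simp only [integral_tsum_inner_pow_mul hζ (h.hasSum_one _).summable (hf _)]
    _ = productEigenvalue ζ A ρ k * prodFun f x := by
        rw [Finset.prod_mul_distrib, ← mul_assoc, productEigenvalue, prodFun_apply]

lemma dotEigenvalue_of_notMem (h : IsProductCoeff b A ρ) (hζ : 0 < ζ) {i : Fin d}
    (hi : i ∉ receptiveField b) (k : ℕ) :
    dotEigenvalue ζ (ρ i) k = if k = 0 then 1 else 0 := by
  rw [dotEigenvalue_of_eq_zero hζ (fun m => h.apply_eq_zero hi), h.apply_zero_eq_one hi]

lemma productEigenvalue_eq_zero (h : IsProductCoeff b A ρ) (hζ : 0 < ζ) {k : Fin d → ℕ} {i : Fin d}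
    (hi : i ∉ receptiveField b) (hk : 0 < k i) : productEigenvalue ζ A ρ k = 0 :=
  mul_eq_zero_of_right _ (Finset.prod_eq_zero (Finset.mem_univ i)
    ((h.dotEigenvalue_of_notMem hζ hi _).trans (if_neg hk.ne')))

variable {c ν : ℝ}

lemma dotEigenvalue_pos (h : IsProductCoeff b A ρ) (hζ : 2 ≤ ζ) (hc : 0 < c)
    (hasymp : b ~[atTopOn (receptiveField b)] fun n => c * powProd (receptiveField b) ν n)
    {i : Fin d} (hi : i ∈ receptiveField b) (k : ℕ) : 0 < dotEigenvalue ζ (ρ i) k := by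
  obtain ⟨l, hl, hρ⟩ := h.exists_isEquivalent hc hasymp hi
  refine Multisphere.dotEigenvalue_pos hζ (h.nonneg i) (h.hasSum_one i).summable
    (hρ.eventually_pos ?_) k
  filter_upwards [eventually_gt_atTop 0] with m hm
  positivity

lemma exists_isEquivalent_dotEigenvalue (h : IsProductCoeff b A ρ) (hζ : 2 ≤ ζ) (hc : 0 < c)
    (hasymp : b ~[atTopOn (receptiveField b)] fun n => c * powProd (receptiveField b) ν n)
    {i : Fin d} (hi : i ∈ receptiveField b) :
    ∃ c', 0 < c' ∧
      dotEigenvalue ζ (ρ i) ~[atTop] fun k : ℕ => c' * (k : ℝ) ^ (-(ζ + 2 * ν - 3)) := by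
  obtain ⟨l, hl, hρ⟩ := h.exists_isEquivalent hc hasymp hi
  have hν := one_lt_of_isEquivalent hl (h.hasSum_one i).summable hρ
  have hζ' : (2 : ℝ) ≤ ζ := by exact_mod_cast hζ
  exact Multisphere.exists_isEquivalent_dotEigenvalue (by omega) (by linarith) hl hρ

theorem exists_isEquivalent_productEigenvalue (h : IsProductCoeff b A ρ) (hζ : 2 ≤ ζ) (hc : 0 < c)
    (hasymp : b ~[atTopOn (receptiveField b)] fun n => c * powProd (receptiveField b) ν n)
    {S : Finset (Fin d)} (hS : S ⊆ receptiveField b) :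
    ∃ c', 0 < c' ∧ productEigenvalue ζ A ρ ~[atTopOn S]
      fun k => c' * powProd (receptiveField b) (ζ + 2 * ν - 3) k := by
  have hpos (i : Fin d) (_ : i ∉ S) : 0 < dotEigenvalue ζ (ρ i) 0 := by
    by_cases hi : i ∈ receptiveField b
    · exact h.dotEigenvalue_pos hζ hc hasymp hi 0
    · simp [h.dotEigenvalue_of_notMem (zero_lt_two.trans_le hζ) hi]
  obtain ⟨c', hc', hequiv⟩ := exists_isEquivalent_prod hS hpos
    fun i hi => h.exists_isEquivalent_dotEigenvalue hζ hc hasymp (hS hi)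
  refine ⟨A * c', mul_pos h.pos hc', ?_⟩
  simp only [mul_assoc]
  exact (Asymptotics.IsEquivalent.refl (u := fun _ => A)).mul hequiv

theorem exists_bounds_productEigenvalue (h : IsProductCoeff b A ρ) (hζ : 2 ≤ ζ) (hc : 0 < c)
    (hasymp : b ~[atTopOn (receptiveField b)] fun n => c * powProd (receptiveField b) ν n) :
    ∃ c₁ c₂ : ℝ, 0 < c₁ ∧ 0 < c₂ ∧ ∀ k : Fin d → ℕ, (∀ i ∉ receptiveField b, k i = 0) →
      c₁ * powProd (receptiveField b) (ζ + 2 * ν - 3) k ≤ productEigenvalue ζ A ρ k ∧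
        productEigenvalue ζ A ρ k ≤ c₂ * powProd (receptiveField b) (ζ + 2 * ν - 3) k := by
  obtain ⟨c₁, c₂, hc₁, hc₂, hbounds⟩ := exists_bounds_prod
    (fun i hi => by rw [h.dotEigenvalue_of_notMem (by omega) hi, if_pos rfl])
    (fun i hi => h.dotEigenvalue_pos hζ hc hasymp hi)
    (fun i hi => h.exists_isEquivalent_dotEigenvalue hζ hc hasymp hi)
  refine ⟨A * c₁, A * c₂, mul_pos h.pos hc₁, mul_pos h.pos hc₂, fun k hk => ?_⟩
  rw [mul_assoc, mul_assoc]
  exact ⟨mul_le_mul_of_nonneg_left (hbounds k hk).1 h.pos.le,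
    mul_le_mul_of_nonneg_left (hbounds k hk).2 h.pos.le⟩

end IsProductCoeff

end FactorizableKernel

end Multisphere

end

open Multisphere in
theorem mainTheorem2_general (ζ d : ℕ) (hζ : 2 ≤ ζ)
    (K : MS ζ d → MS ζ d → ℝ) (hK : IsFactorizable K)
    (b : (Fin d → ℕ) → ℝ) (hb : ∀ n, 0 ≤ b n) (hKb : HasPowerSeries K b)
    (R : Finset (Fin d)) (hR : R = receptiveField b)
    (c ν : ℝ) (hc : 0 < c)
    (hasymp : b ~[atTopOn R] fun n => c * powProd R ν n) :
    (∀ Y, IsHarmonicSystem ζ Y →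
      Orthonormal ℝ (fun p => ContinuousMap.toLp (E := ℝ) 2 (unif ζ d) ℝ
        (shProduct (d := d) Y p)) ∧
      (Submodule.span ℝ (Set.range fun p => ContinuousMap.toLp (E := ℝ) 2 (unif ζ d) ℝ
        (shProduct (d := d) Y p))).topologicalClosure = ⊤) ∧
    ∃ lam : (Fin d → ℕ) → ℝ,
      (∀ (k : Fin d → ℕ) (f : Fin d → C(Sph ζ, ℝ)),
        (∀ i, f i ∈ sphHarm ζ (k i)) → ∀ x,
          ∫ z, K x z * prodFun f z ∂(unif ζ d) =
            lam k * prodFun f x) ∧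
      (∀ S ⊆ R, ∃ c' : ℝ, 0 < c' ∧
        lam ~[atTopOn S] fun k => c' * powProd R (ζ + 2 * ν - 3) k) ∧
      (∃ c₁ c₂ : ℝ, 0 < c₁ ∧ 0 < c₂ ∧ ∀ k : Fin d → ℕ, (∀ i ∉ R, k i = 0) →
        c₁ * powProd R (ζ + 2 * ν - 3) k ≤ lam k ∧
          lam k ≤ c₂ * powProd R (ζ + 2 * ν - 3) k) ∧
      (∀ k : Fin d → ℕ, (∃ i ∉ R, 0 < k i) → lam k = 0) := by
  subst hR
  obtain ⟨A, ρ, hρ⟩ := hK.exists_isProductCoeff hζ hb (ne_zero_of_isEquivalent hc hasymp) hKb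
  exact ⟨fun Y hY => ⟨orthonormal_toLp_shProduct (by omega) hY d,
      topologicalClosure_span_toLp_shProduct (by omega) hY d⟩,
    productEigenvalue ζ A ρ,
    fun k f hf x => hρ.integral_mul_prodFun hζ hKb hf x,
    fun S hS => hρ.exists_isEquivalent_productEigenvalue hζ hc hasymp hS,
    hρ.exists_bounds_productEigenvalue hζ hc hasymp,
    fun k ⟨i, hi, hk⟩ => hρ.productEigenvalue_eq_zero (by omega) hi hk⟩

theorem mainTheorem2 (ζ d : ℕ) (hζ : 2 ≤ ζ)
    (K : Multisphere.MS ζ d → Multisphere.MS ζ d → ℝ) (hK : Multisphere.IsFactorizable K)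
    (b : (Fin d → ℕ) → ℝ) (hb : ∀ n, 0 ≤ b n) (hKb : Multisphere.HasPowerSeries K b)
    (R : Finset (Fin d)) (hR : R = Multisphere.receptiveField b)
    (c ν : ℝ) (hc : 0 < c) (hν : 1 < ν) (hν' : ∀ m : ℤ, ν ≠ m)
    (hasymp : b ~[Multisphere.atTopOn R] fun n => c * Multisphere.powProd R ν n) :
    -- the SH-products form an orthonormal basis of `L²` with respect to the uniform measure
    (∀ Y, Multisphere.IsHarmonicSystem ζ Y →
      Orthonormal ℝ (fun p => ContinuousMap.toLp (E := ℝ) 2 (Multisphere.unif ζ d) ℝ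
        (Multisphere.shProduct (d := d) Y p)) ∧
      (Submodule.span ℝ (Set.range fun p => ContinuousMap.toLp (E := ℝ) 2 (Multisphere.unif ζ d) ℝ
        (Multisphere.shProduct (d := d) Y p))).topologicalClosure = ⊤) ∧
    ∃ lam : (Fin d → ℕ) → ℝ,
      -- every SH-product of frequencies `k` is an eigenfunction with eigenvalue `lam k`
      (∀ (k : Fin d → ℕ) (f : Fin d → C(Multisphere.Sph ζ, ℝ)),
        (∀ i, f i ∈ Multisphere.sphHarm ζ (k i)) → ∀ x,
          ∫ z, K x z * Multisphere.prodFun f z ∂(Multisphere.unif ζ d) =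
            lam k * Multisphere.prodFun f x) ∧
      -- the asymptotics, for each set `S` of pixels with nonzero frequency
      (∀ S ⊆ R, ∃ c' : ℝ, 0 < c' ∧
        lam ~[Multisphere.atTopOn S] fun k => c' * Multisphere.powProd R (ζ + 2 * ν - 3) k) ∧
      -- the rate holds up to constant factors uniformly over all frequencies in `R`
      (∃ c₁ c₂ : ℝ, 0 < c₁ ∧ 0 < c₂ ∧ ∀ k : Fin d → ℕ, (∀ i ∉ R, k i = 0) →
        c₁ * Multisphere.powProd R (ζ + 2 * ν - 3) k ≤ lam k ∧
          lam k ≤ c₂ * Multisphere.powProd R (ζ + 2 * ν - 3) k) ∧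
      -- the eigenvalues vanish outside of the receptive field
      (∀ k : Fin d → ℕ, (∃ i ∉ R, 0 < k i) → lam k = 0) :=
  mainTheorem2_general ζ d hζ K hK b hb hKb R hR c ν hc hasymp
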